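/- **Model.** Two chains have finite sets $\mathcal A_1,\mathcal A_2$ of orbitals per unit cell and lattice constants $a_1=1$, $a_2=1-\theta$, where $\theta<1$. The orbitals are $R\alpha$ with $R\in\mathcal R_i=a_i\mathbb Z$, $\alpha\in\mathcal A_i$, located at $R+\tau_\alpha$, with $\tau_\alpha\in[0,a_i]$ for $\alpha\in\mathcal A_i$. Given real numbers $t_{\alpha,\alpha'},\epsilon_{\alpha,\alpha'}$ ($\alpha,\alpha'$ in the same $\mathcal A_i$) and a function $h:\mathbb R\to\mathbb R$ with $|h(x)|\le h_0e^{-\gamma|x|}$ for all $x$ ($h_0,\gamma>0$), the Hamiltonian with shift $d\in\mathbb R$ has the following entries. Inside chain $i$, $H_{\theta,d}(R\alpha,R'\alpha')$ equals $t_{\alpha,\alpha'}$, $t_{\alpha',\alpha}$, $\epsilon_{\alpha,\alpha'}$, $0$ if $R-R'=a_i$, $R-R'=-a_i$, $R=R'$, or none of these, respectively. For $R\alpha$ in chain $i$ and $R'\alpha'$ in chain $j\ne i$, $H_{\theta,d}(R\alpha,R'\alpha')=h(|R+\tau_\alpha+d(-\delta_{i1}+\delta_{i2})-R'-\tau_{\alpha'}|)$.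 **Rational mismatch.** Let $q(1-\theta)=p$ with coprime positive integers $p,q$. Put $\mathcal R^s=p\mathbb Z$, $\mathcal A^s=(\{0,\dots,p-1\}\times\mathcal A_1)\cup(\{0,\dots,q-1\}\times\mathcal A_2)$, with $\tau_{(n,\alpha)}=na_i+\tau_\alpha$ for $\alpha\in\mathcal A_i$, and $N=|\mathcal A^s|=p|\mathcal A_1|+q|\mathcal A_2|$. The orbitals are thereby relabelled by $\mathcal R^s\times\mathcal A^s$. Let $H_{\mathrm{trunc}}$ be $H_{\theta,d}$ with every interlayer entry between supercells $R,R'\in\mathcal R^s$ with $|R-R'|>cp$ replaced by $0$. With the Bloch transform $$[\mathcal G\psi]_\alpha(k)=|\Gamma^*|^{-1/2}\sum_{R\in\mathcal R^s}\psi(R\alpha)e^{-ik(R+\tau_\alpha)},\qquad |\Gamma^*|=\frac{2\pi}{p},$$ let $H_{\theta,d}(k)$ and $H_{k,\mathrm{trunc}}$ be the $\mathcal A^s\times\mathcal A^s$ matrices with $[\mathcal GH_{\theta,d}\psi](k)=H_{\theta,d}(k)[\mathcal G\psi](k)$ and $[\mathcal GH_{\mathrm{trunc}}\psi](k)=H_{k,\mathrm{trunc}}[\mathcal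 G\psi](k)$; explicitly, $H(k)_{\alpha\beta}=\sum_{R\in\mathcal R^s}H(R\alpha,0\beta)\,e^{-ik(R+\tau_\alpha-\tau_\beta)}$. **Local density of states.** Let $\mathcal I_{2,d}$ be the set of orbitals $R\alpha$ of chain 2 with $R+\tau_\alpha+d\in\{d+(1-\theta)\beta:\beta\in[0,1)\}$. For a real polynomial $g$ and $E\in\mathbb R$ put $$\rho_\theta(d,E)=\frac1{|\Gamma^*|}\sum_{\alpha:R\alpha\in\mathcal I_{2,d}}\int_0^{2\pi/p}g(H_{\theta,d}(k)-E)_{\alpha\alpha}\,dk,\qquad \varrho_\theta(d,E)=\frac1{|\Gamma^*|}\sum_{\alpha:R\alpha\in\mathcal I_{2,d}}\sum_{i=1}^M g(H_{k_i,\mathrm{trunc}}-E)_{\alpha\alpha}\,\Delta k,$$ where $k_i=\frac{2\pi i}{pM}$, $\Delta k=\frac{2\pi}{pM}$, and the sums run over the indices $\alpha\in\mathcal A^s$ of the orbitals in $\mathcal I_{2,d}$. **Theorem.** Fix $\mathcal A_1$, $\mathcal A_2$, all $t$ and $\epsilon$, $h$, $h_0$, $\gamma$, $g$, $d$ and $E$.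 There are constants $C_2=C_2(N)$, depending on these data and on $N$, and, for every interval $[\theta_0,\theta_1]$ with $\theta_1<1$, a constant $C_1$, depending on these data and on the interval, such that for every rational $\theta\in[\theta_0,\theta_1]$, every choice of the shifts $\tau_\alpha\in[0,a_i]$, and all integers $M\ge1$ and $c>3$, $$|\rho_\theta(d,E)-\varrho_\theta(d,E)|\le\left(\frac{C_1}{p\,e^{p\gamma M/2}-p}+\frac{C_2(N)\,e^{-\gamma cp}}{\gamma p}\right)\frac{|\mathcal I_{2,d}|}{|\Gamma^*|}.$$ In particular, for fixed $\theta$ the error decays exponentially in $M$ and $c$. -/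

import Mathlib

open scoped Real

namespace CoupledChain

noncomputable section

/-- Hopping data of two coupled chains with sets `A₁`, `A₂` of orbitals per unit cell: the
intralayer hopping energies `t`, `ε` of each chain and the interlayer hopping function `h`. -/
structure Hopping (A₁ A₂ : Type*) where
  t₁ : A₁ → A₁ → ℝ
  ε₁ : A₁ → A₁ → ℝ
  t₂ : A₂ → A₂ → ℝ
  ε₂ : A₂ → A₂ → ℝ
  h : ℝ → ℝ

/-- Orbitals `Rα`: `Sum.inl (n, α)` is the orbital `α` in the cell `R = n` of chain 1 (lattice
constant `1`), `Sum.inr (n, α)` the orbital `α` in the cell `R = n (1 - θ)` of chain 2. -/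
abbrev Site (A₁ A₂ : Type*) := (ℤ × A₁) ⊕ (ℤ × A₂)

/-- Supercell orbital indices `𝒜ˢ = 𝒜₁ˢ ∪ 𝒜₂ˢ`: a supercell of length `p = q (1 - θ)` consists of
`p` unit cells of chain 1 and `q` unit cells of chain 2. -/
abbrev SuperIdx (p q : ℕ) (A₁ A₂ : Type*) := (Fin p × A₁) ⊕ (Fin q × A₂)

/-- Intralayer hopping energy between `Rα` and `R'α'`, where `R - R' = n aᵢ`. -/
def intra {A : Type*} (t ε : A → A → ℝ) (n : ℤ) (α α' : A) : ℝ :=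
  if n = 1 then t α α' else if n = -1 then t α' α else if n = 0 then ε α α' else 0

/-- The tight binding Hamiltonian `H_{θ,d}(Rα, R'α')` of the coupled chain, with
orbital shifts `τ₁`, `τ₂` inside the unit cells. -/
def hamiltonian {A₁ A₂ : Type*} (m : Hopping A₁ A₂) (τ₁ : A₁ → ℝ) (τ₂ : A₂ → ℝ) (θ d : ℝ) :
    Site A₁ A₂ → Site A₁ A₂ → ℝ
  | .inl (n, α), .inl (n', α') => intra m.t₁ m.ε₁ (n - n') α α'
  | .inr (n, α), .inr (n', α') => intra m.t₂ m.ε₂ (n - n') α α'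
  | .inl (n, α), .inr (n', α') => m.h |n + τ₁ α - d - n' * (1 - θ) - τ₂ α'|
  | .inr (n, α), .inl (n', α') => m.h |n * (1 - θ) + τ₂ α + d - n' - τ₁ α'|

/-- The identification of `ℛˢ × 𝒜ˢ` with the set of orbitals; `(n, σ)` is the orbital `σ` of the
supercell `R = p n`. -/
def relabel {p q : ℕ} {A₁ A₂ : Type*} : ℤ × SuperIdx p q A₁ A₂ → Site A₁ A₂
  | (n, .inl (j, α)) => .inl (n * p + j, α)
  | (n, .inr (j, α)) => .inr (n * q + j, α)

/-- Position `τ_σ` of the supercell orbital `σ` relative to the supercell. -/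
def superShift {p q : ℕ} {A₁ A₂ : Type*} (τ₁ : A₁ → ℝ) (τ₂ : A₂ → ℝ) (θ : ℝ) :
    SuperIdx p q A₁ A₂ → ℝ
  | .inl (j, α) => (j : ℕ) + τ₁ α
  | .inr (j, α) => (j : ℕ) * (1 - θ) + τ₂ α

/-- The Hamiltonian `H_{θ,d}` written in supercell indices. -/
def superHamiltonian {A₁ A₂ : Type*} (m : Hopping A₁ A₂) (τ₁ : A₁ → ℝ) (τ₂ : A₂ → ℝ) (θ d : ℝ)
    (p q : ℕ) (x y : ℤ × SuperIdx p q A₁ A₂) : ℝ :=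
  hamiltonian m τ₁ τ₂ θ d (relabel x) (relabel y)

/-- The truncated Hamiltonian: interlayer entries between supercells `R`, `R'` with
`|R - R'| > c p` are replaced by `0`, all other entries are kept. -/
def truncHamiltonian {A₁ A₂ : Type*} (m : Hopping A₁ A₂) (τ₁ : A₁ → ℝ) (τ₂ : A₂ → ℝ) (θ d : ℝ)
    (p q c : ℕ) (x y : ℤ × SuperIdx p q A₁ A₂) : ℝ :=
  if x.2.isLeft ≠ y.2.isLeft ∧ (c * p : ℤ) < |p * x.1 - p * y.1| then 0
  else superHamiltonian m τ₁ τ₂ θ d p q x y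

/-- The action `(Hψ)(x) = ∑_y H(x, y) ψ(y)` of a Hamiltonian on a wave function. -/
def act {S : Type*} (K : ℤ × S → ℤ × S → ℝ) (ψ : ℤ × S → ℂ) (x : ℤ × S) : ℂ :=
  ∑' y, (K x y : ℂ) * ψ y

/-- `|Γ*| = 2π / p`, the length of the Brillouin zone. -/
def zoneLength (p : ℕ) : ℝ := 2 * π / p

/-- The Bloch transform `[𝒢ψ]_α(k) = |Γ*|^{-1/2} ∑_{R ∈ ℛˢ} ψ(Rα) e^{-ik(R + τ_α)}`, `R = p n`. -/
def blochTransform {S : Type*} (p : ℕ) (τ : S → ℝ) (ψ : ℤ × S → ℂ) (k : ℝ) (α : S) : ℂ :=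
  ((1 / √(zoneLength p) : ℝ) : ℂ) *
    ∑' n : ℤ, ψ (n, α) * Complex.exp (-(Complex.I * (k * (p * n + τ α) : ℝ)))

/-- The Bloch transformed Hamiltonian `H(k) = [𝒢H𝒢⁻¹](k)`. By `blochTransform_act` and
`blochMatrix_unique` it is the only matrix with `[𝒢Hψ](k) = H(k) [𝒢ψ](k)` for all `ψ`. -/
def blochMatrix {S : Type*} (p : ℕ) (τ : S → ℝ) (K : ℤ × S → ℤ × S → ℝ) (k : ℝ) :
    Matrix S S ℂ :=
  Matrix.of fun α β => ∑' n : ℤ,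
    (K (n, α) (0, β) : ℂ) * Complex.exp (-(Complex.I * (k * (p * n + τ α - τ β) : ℝ)))

/-- `H_{θ,d}(k)` -/
def blochHamiltonian {A₁ A₂ : Type*} (m : Hopping A₁ A₂) (τ₁ : A₁ → ℝ) (τ₂ : A₂ → ℝ) (θ d : ℝ)
    (p q : ℕ) (k : ℝ) : Matrix (SuperIdx p q A₁ A₂) (SuperIdx p q A₁ A₂) ℂ :=
  blochMatrix p (superShift τ₁ τ₂ θ) (superHamiltonian m τ₁ τ₂ θ d p q) k

/-- `H_{k,trunc}` -/
def blochTrunc {A₁ A₂ : Type*} (m : Hopping A₁ A₂) (τ₁ : A₁ → ℝ) (τ₂ : A₂ → ℝ) (θ d : ℝ)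
    (p q c : ℕ) (k : ℝ) : Matrix (SuperIdx p q A₁ A₂) (SuperIdx p q A₁ A₂) ℂ :=
  blochMatrix p (superShift τ₁ τ₂ θ) (truncHamiltonian m τ₁ τ₂ θ d p q c) k

/-- The shifted unit cell `Γ_{2,d} = {d + (1 - θ) β : β ∈ [0, 1)}` of chain 2. -/
def homeCell (θ d : ℝ) : Set ℝ := (fun β => d + (1 - θ) * β) '' Set.Ico 0 1

/-- `ℐ_{2,d}`: the orbitals `Rα` of chain 2 with `R + τ_α + d ∈ Γ_{2,d}`, `R = n (1 - θ)`. -/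
def homeOrbitals {A₂ : Type*} (τ₂ : A₂ → ℝ) (θ d : ℝ) : Set (ℤ × A₂) :=
  {x | x.1 * (1 - θ) + τ₂ x.2 + d ∈ homeCell θ d}

open Classical in
/-- The supercell indices of the orbitals in `ℐ_{2,d}`. -/
def homeIndices {A₁ A₂ : Type*} [Fintype A₁] [Fintype A₂] (τ₂ : A₂ → ℝ) (θ d : ℝ) (p q : ℕ) :
    Finset (SuperIdx p q A₁ A₂) :=
  Finset.univ.filter fun σ => ∃ n : ℤ, ∃ x ∈ homeOrbitals τ₂ θ d, relabel (n, σ) = Sum.inr x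

/-- `g(A - E)` for a polynomial `g` and a square matrix `A`. -/
def shiftedPoly {S : Type*} [Fintype S] [DecidableEq S] (g : Polynomial ℝ) (A : Matrix S S ℂ)
    (E : ℝ) : Matrix S S ℂ :=
  Polynomial.aeval (A - (E : ℂ) • (1 : Matrix S S ℂ)) g

section LDOS

variable {A₁ A₂ : Type*} [Fintype A₁] [Fintype A₂] [DecidableEq A₁] [DecidableEq A₂]

/-- The momentum space local density of states
`ρ_θ(d,E) = |Γ*|⁻¹ ∑_σ ∫_0^{2π/p} g(H_{θ,d}(k) - E)_{σσ} dk`. -/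
def ldos (m : Hopping A₁ A₂) (g : Polynomial ℝ) (τ₁ : A₁ → ℝ) (τ₂ : A₂ → ℝ) (θ : ℝ) (p q : ℕ)
    (d E : ℝ) : ℂ :=
  ((1 / zoneLength p : ℝ) : ℂ) * ∑ σ ∈ homeIndices (A₁ := A₁) τ₂ θ d p q,
    ∫ k in (0 : ℝ)..(2 * π / p), shiftedPoly g (blochHamiltonian m τ₁ τ₂ θ d p q k) E σ σ

/-- Its numerical approximation
`ϱ_θ(d,E) = |Γ*|⁻¹ ∑_σ ∑_{i=1}^M g(H_{k_i,trunc} - E)_{σσ} Δk`, `k_i = 2πi/(pM)`,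
`Δk = 2π/(pM)`. -/
def ldosApprox (m : Hopping A₁ A₂) (g : Polynomial ℝ) (τ₁ : A₁ → ℝ) (τ₂ : A₂ → ℝ) (θ : ℝ)
    (p q : ℕ) (M c : ℕ) (d E : ℝ) : ℂ :=
  ((1 / zoneLength p : ℝ) : ℂ) * ∑ σ ∈ homeIndices (A₁ := A₁) τ₂ θ d p q,
    ∑ i ∈ Finset.Icc 1 M,
      shiftedPoly g (blochTrunc m τ₁ τ₂ θ d p q c (2 * π * i / (p * M))) E σ σ *
        ((2 * π / (p * M) : ℝ) : ℂ)

end LDOS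

/-! ### The Bloch transformed Hamiltonian represents the Hamiltonian -/

/-- A kernel is periodic when it is invariant under translation by supercells. -/
def IsPeriodic {S : Type*} (K : ℤ × S → ℤ × S → ℝ) : Prop :=
  ∀ (l n n' : ℤ) (α β : S), K (n + l, α) (n' + l, β) = K (n, α) (n', β)

/-- `[𝒢Hψ](k) = H(k) [𝒢ψ](k)` for finitely supported `ψ`. -/
theorem blochTransform_act {S : Type*} [Fintype S] (p : ℕ) (τ : S → ℝ)
    (K : ℤ × S → ℤ × S → ℝ) (hK : IsPeriodic K)
    (hs : ∀ α β, Summable fun n : ℤ => K (n, α) (0, β))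
    (ψ : ℤ × S → ℂ) (hψ : (Function.support ψ).Finite) (k : ℝ) :
    blochTransform p τ (act K ψ) k = (blochMatrix p τ K k).mulVec (blochTransform p τ ψ k) := by
  classical
  set F := hψ.toFinset with hF
  have hz : ∀ y, y ∉ F → ψ y = 0 := by
    intro y hy; simpa [hF] using hy
  have hact : ∀ x, act K ψ x = ∑ y ∈ F, (K x y : ℂ) * ψ y := by
    intro x
    exact tsum_eq_sum fun y hy => by simp [hz y hy]
  set T := F.image Prod.fst with hT
  have hzT : ∀ n β, n ∉ T → ψ (n, β) = 0 := by
    intro n β hn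
    apply hz
    intro h
    exact hn (Finset.mem_image_of_mem Prod.fst h)
  have hact2 : ∀ x, act K ψ x = ∑ β, ∑ l ∈ T, (K x (l, β) : ℂ) * ψ (l, β) := by
    intro x
    rw [hact, ← Finset.sum_product_right']
    apply Finset.sum_subset
    · intro y hy
      simp only [Finset.mem_product, Finset.mem_univ, and_true]
      exact Finset.mem_image_of_mem Prod.fst hy
    · intro y _ hy
      simp [hz y hy]
  have hnorm : ∀ x : ℝ, ‖Complex.exp (-(Complex.I * (x : ℝ)))‖ = 1 := by
    intro x
    rw [Complex.norm_exp]; simp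
  have hsum : ∀ α β (l : ℤ) (f : ℤ → ℝ), Summable fun n : ℤ =>
      (K (n, α) (l, β) : ℂ) * Complex.exp (-(Complex.I * (f n : ℝ))) := by
    intro α β l f
    apply Summable.of_norm
    have h1 : Summable fun n : ℤ => |K (n, α) (l, β)| := by
      have h0 := (Equiv.subRight l).summable_iff.mpr (hs α β).abs
      refine h0.congr fun n => ?_
      have := hK l (n - l) 0 α β
      simp only [sub_add_cancel, zero_add] at this
      simp [this]
    refine h1.congr fun n => ?_
    rw [norm_mul, hnorm, mul_one, Complex.norm_real, Real.norm_eq_abs]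
  have hshift : ∀ α β (l : ℤ), ∑' n : ℤ,
      (K (n, α) (l, β) : ℂ) * Complex.exp (-(Complex.I * (k * (p * n + τ α) : ℝ))) =
      blochMatrix p τ K k α β * Complex.exp (-(Complex.I * (k * (p * l + τ β) : ℝ))) := by
    intro α β l
    rw [blochMatrix, Matrix.of_apply, ← tsum_mul_right, ← (Equiv.addRight l).tsum_eq]
    refine tsum_congr fun n => ?_
    have := hK l n 0 α β
    rw [zero_add] at this
    simp only [Equiv.coe_addRight, this]
    rw [mul_assoc, ← Complex.exp_add]
    congr 2
    push_cast
    ring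
  funext α
  simp only [Matrix.mulVec, dotProduct, blochTransform]
  have e1 : ∀ β, ∑' n : ℤ, ψ (n, β) * Complex.exp (-(Complex.I * (k * (p * n + τ β) : ℝ))) =
      ∑ l ∈ T, ψ (l, β) * Complex.exp (-(Complex.I * (k * (p * l + τ β) : ℝ))) := by
    intro β
    exact tsum_eq_sum fun n hn => by simp [hzT n β hn]
  simp only [e1, hact2]
  have e2 : ∀ n : ℤ, (∑ β, ∑ l ∈ T, (K (n, α) (l, β) : ℂ) * ψ (l, β)) *
        Complex.exp (-(Complex.I * (k * (p * n + τ α) : ℝ))) =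
      ∑ β, ∑ l ∈ T, ((K (n, α) (l, β) : ℂ) *
        Complex.exp (-(Complex.I * (k * (p * n + τ α) : ℝ)))) * ψ (l, β) := by
    intro n
    simp only [Finset.sum_mul]
    refine Finset.sum_congr rfl fun β _ => Finset.sum_congr rfl fun l _ => by ring
  simp only [e2]
  rw [Summable.tsum_finsetSum (fun β _ => summable_sum fun l _ =>
    (hsum α β l fun n => k * (p * n + τ α)).mul_right _), Finset.mul_sum]
  refine Finset.sum_congr rfl fun β _ => ?_
  rw [Summable.tsum_finsetSum (fun l _ => (hsum α β l fun n => k * (p * n + τ α)).mul_right _),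
    Finset.mul_sum, Finset.mul_sum, Finset.mul_sum]
  refine Finset.sum_congr rfl fun l _ => ?_
  rw [tsum_mul_right, hshift]
  ring

/-- The intertwining relation determines `H(k)`. -/
theorem blochMatrix_unique {S : Type*} [Fintype S] (p : ℕ) (hp : 0 < p) (τ : S → ℝ)
    (K : ℤ × S → ℤ × S → ℝ) (k : ℝ) (B : Matrix S S ℂ) (hK : IsPeriodic K)
    (hs : ∀ α β, Summable fun n : ℤ => K (n, α) (0, β))
    (hB : ∀ ψ : ℤ × S → ℂ, (Function.support ψ).Finite →
      blochTransform p τ (act K ψ) k = B.mulVec (blochTransform p τ ψ k)) :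
    B = blochMatrix p τ K k := by
  classical
  ext α β
  have hsupp : (Function.support (Pi.single ((0 : ℤ), β) (1 : ℂ))).Finite :=
    (Set.finite_singleton ((0 : ℤ), β)).subset Pi.support_single_subset
  have h1 := (hB _ hsupp).symm.trans (blochTransform_act p τ K hK hs _ hsupp k)
  have hv : blochTransform p τ (Pi.single ((0 : ℤ), β) (1 : ℂ)) k =
      Pi.single β (((1 / √(zoneLength p) : ℝ) : ℂ) *
        Complex.exp (-(Complex.I * (k * τ β : ℝ)))) := by
    funext γ
    by_cases hγ : γ = β
    · subst hγ
      rw [blochTransform, tsum_eq_single 0]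
      · simp
      · intro n hn
        rw [Pi.single_eq_of_ne (by simpa using hn), zero_mul]
    · rw [blochTransform, Pi.single_eq_of_ne hγ]
      have : ∀ n : ℤ, (Pi.single ((0 : ℤ), β) (1 : ℂ) : ℤ × S → ℂ) (n, γ) = 0 := by
        intro n
        rw [Pi.single_eq_of_ne]
        simp [hγ]
      simp [this]
  have hne : ((1 / √(zoneLength p) : ℝ) : ℂ) * Complex.exp (-(Complex.I * (k * τ β : ℝ))) ≠ 0 := by
    refine mul_ne_zero ?_ (Complex.exp_ne_zero _)
    have : 0 < zoneLength p := by unfold zoneLength; positivity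
    have : (1 / √(zoneLength p)) ≠ 0 := by positivity
    exact_mod_cast this
  rw [hv] at h1
  have h2 := congrFun h1 α
  simp only [Matrix.mulVec_single, Pi.smul_apply, MulOpposite.smul_eq_mul_unop,
    MulOpposite.unop_op, Matrix.col_apply] at h2
  exact mul_right_cancel₀ hne h2

/-- The coupled chain Hamiltonian with rational mismatch is periodic. -/
theorem superHamiltonian_periodic {A₁ A₂ : Type*} (m : Hopping A₁ A₂) (τ₁ : A₁ → ℝ) (τ₂ : A₂ → ℝ)
    (θ d : ℝ) (p q : ℕ) (hpq : (q : ℝ) * (1 - θ) = p) :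
    IsPeriodic (superHamiltonian m τ₁ τ₂ θ d p q) := by
  rintro l n n' (⟨j, α⟩ | ⟨j, α⟩) (⟨j', β⟩ | ⟨j', β⟩) <;>
    simp only [superHamiltonian, relabel, hamiltonian]
  · congr 1; ring
  · congr 2; push_cast; linear_combination (-(l : ℝ)) * hpq
  · congr 2; push_cast; linear_combination (l : ℝ) * hpq
  · congr 1; ring

/-- So is the truncated one. -/
theorem truncHamiltonian_periodic {A₁ A₂ : Type*} (m : Hopping A₁ A₂) (τ₁ : A₁ → ℝ) (τ₂ : A₂ → ℝ)
    (θ d : ℝ) (p q c : ℕ) (hpq : (q : ℝ) * (1 - θ) = p) :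
    IsPeriodic (truncHamiltonian m τ₁ τ₂ θ d p q c) := by
  intro l n n' α β
  have h := superHamiltonian_periodic m τ₁ τ₂ θ d p q hpq l n n' α β
  have e : (p : ℤ) * (n + l) - p * (n' + l) = p * n - p * n' := by ring
  simp only [truncHamiltonian, h, e]

/-- Intralayer hopping has finite range. -/
theorem intra_summable {A : Type*} (t ε : A → A → ℝ) (r : ℕ) (hr : 0 < r) (s : ℤ) (a b : A) :
    Summable fun n : ℤ => intra t ε (n * r + s) a b := by
  have hsub : (Function.support fun n : ℤ => intra t ε (n * r + s) a b) ⊆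
      Set.Icc (-(1 + |s|)) (1 + |s|) := by
    intro n hn
    have hne : intra t ε (n * r + s) a b ≠ 0 := hn
    have h3 : |n * r + s| ≤ 1 := by
      by_contra hcon
      apply hne
      rw [abs_le] at hcon
      unfold intra
      rw [if_neg (by omega), if_neg (by omega), if_neg (by omega)]
    have h4 : |n * (r : ℤ)| ≤ 1 + |s| := by
      have := abs_sub (n * (r : ℤ) + s) s
      rw [add_sub_cancel_right] at this
      linarith
    have h5 : |n| ≤ |n * (r : ℤ)| := by
      rw [abs_mul]
      have : (1 : ℤ) ≤ |(r : ℤ)| := by rw [Nat.abs_cast]; exact_mod_cast hr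
      nlinarith [abs_nonneg n]
    exact abs_le.mp (h5.trans h4)
  exact summable_of_hasFiniteSupport ((Set.finite_Icc _ _).subset hsub)

/-- Exponentially decaying interlayer hopping gives summable columns. -/
theorem superHamiltonian_summable {A₁ A₂ : Type*} (m : Hopping A₁ A₂) (τ₁ : A₁ → ℝ)
    (τ₂ : A₂ → ℝ) (θ d : ℝ) (p q : ℕ) (hp : 0 < p) (hpq : (q : ℝ) * (1 - θ) = p)
    (h₀ γ : ℝ) (hγ : 0 < γ) (hh : ∀ x, |m.h x| ≤ h₀ * Real.exp (-γ * |x|))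
    (α β : SuperIdx p q A₁ A₂) :
    Summable fun n : ℤ => superHamiltonian m τ₁ τ₂ θ d p q (n, α) (0, β) := by
  have hp' : (0 : ℝ) < p := by exact_mod_cast hp
  have hq : 0 < q := by
    rcases Nat.eq_zero_or_pos q with h | h
    · subst h; simp at hpq; linarith
    · exact h
  have h₀0 : 0 ≤ h₀ := by simpa using (abs_nonneg _).trans (hh 0)
  have geo : Summable fun n : ℤ => Real.exp (-(γ * p) * |(n : ℝ)|) := by
    have hnat : Summable fun n : ℕ => Real.exp (-(γ * p) * n) := by
      have h1 := Real.summable_exp_nat_mul_of_ge (c := -(γ * p)) (by nlinarith) (f := fun n => n)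
        (fun n => le_refl _)
      simpa using h1
    refine Summable.of_nat_of_neg ?_ ?_
    · simpa using hnat
    · simpa using hnat
  have inter : ∀ a : ℝ, Summable fun n : ℤ => m.h |p * n + a| := by
    intro a
    refine Summable.of_norm_bounded (geo.mul_left (h₀ * Real.exp (γ * |a|))) fun n => ?_
    rw [Real.norm_eq_abs]
    refine (hh _).trans ?_
    rw [mul_assoc, ← Real.exp_add, abs_abs]
    have h1 : (p : ℝ) * |(n : ℝ)| ≤ |p * n + a| + |a| := by
      have := abs_sub (p * (n : ℝ) + a) a
      rw [add_sub_cancel_right, abs_mul, abs_of_pos hp'] at this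
      exact this
    gcongr
    nlinarith
  rcases α with ⟨j, α⟩ | ⟨j, α⟩ <;> rcases β with ⟨j', β⟩ | ⟨j', β⟩ <;>
    simp only [superHamiltonian, relabel, hamiltonian]
  · refine (intra_summable m.t₁ m.ε₁ p hp (j - j') α β).congr fun n => ?_
    congr 1; ring
  · refine (inter (j + τ₁ α - d - j' * (1 - θ) - τ₂ β)).congr fun n => ?_
    congr 2; push_cast; ring
  · refine (inter (j * (1 - θ) + τ₂ α + d - j' - τ₁ β)).congr fun n => ?_
    congr 2; push_cast; linear_combination (-(n : ℝ)) * hpq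
  · refine (intra_summable m.t₂ m.ε₂ q hq (j - j') α β).congr fun n => ?_
    congr 1; ring

/-- Truncation keeps columns summable. -/
theorem truncHamiltonian_summable {A₁ A₂ : Type*} (m : Hopping A₁ A₂) (τ₁ : A₁ → ℝ)
    (τ₂ : A₂ → ℝ) (θ d : ℝ) (p q c : ℕ) (hp : 0 < p) (hpq : (q : ℝ) * (1 - θ) = p)
    (h₀ γ : ℝ) (hγ : 0 < γ) (hh : ∀ x, |m.h x| ≤ h₀ * Real.exp (-γ * |x|))
    (α β : SuperIdx p q A₁ A₂) :
    Summable fun n : ℤ => truncHamiltonian m τ₁ τ₂ θ d p q c (n, α) (0, β) := by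
  refine Summable.of_norm_bounded
    (superHamiltonian_summable m τ₁ τ₂ θ d p q hp hpq h₀ γ hγ hh α β).abs fun n => ?_
  rw [Real.norm_eq_abs, truncHamiltonian]
  split_ifs
  · simp
  · exact le_refl _

end

end CoupledChain

/-!
The error splits into a quadrature error of the untruncated Hamiltonian and a truncation error.

**Quadrature.** The entries of `H(k)` are exponential series `∑ a_n e^{-ik(pn + τ_α - τ_β)}` whose
coefficients are the entries of the real space Hamiltonian, and these decay like `e^{-γ |x|}` in the
distance (`exists_hamiltonian_decay`). Give such a series the norm `∑ |a_n| e^{γ |pn + τ_α - τ_β| / 2}`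
(`HasExpSeries`). This norm is submultiplicative, so matrices with bounded column sums of entry norms
are stable under polynomials, with a bound that does not see the size of the matrix
(`HasExpSeriesMatrix.shiftedPoly`). For `H(k)` itself the column sums are lattice sums of
`e^{-γ |x| / 2}` over the positions of all orbitals; these depend only on the number of orbitals per
cell and on a lower bound for the lattice constants (`exists_hasExpSeriesMatrix`). This is why `C₁`
depends on the interval of `θ` and not on `p`, `q` or the shifts. On a diagonal entry of
`g(H(k) - E)`, a series in `e^{-ipnk}`, the trapezoidal rule with `M` nodes fails only on the
frequencies with `M ∣ n ≠ 0`, which carry at most the fraction `e^{-γpM/2}` of the weighted norm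
(`HasExpSeries.norm_trapezoid_le`), and `e^{-x} ≤ 1 / (e^x - 1)`.

**Truncation.** For fixed `p` and `q` truncation drops the interlayer terms with `|n| > c`, of total
size `O(e^{-γcp})`, and a polynomial is Lipschitz on bounded sets of matrices
(`exists_shiftedPoly_blochTrunc_error`). The constant may depend on `p` and `q`: if both chains have
orbitals then `p, q ≤ N`, so that a sum over these pairs is a function of `N`. If chain 1 has no
orbitals nothing is truncated, and if chain 2 has none both sides vanish.
-/

namespace CoupledChain

/-! ### Weighted exponential series -/

/-- `f` is the sum of an exponential series `∑ᵢ aᵢ e^{-ik(p nᵢ + s)}`, with frequencies in the coset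
`s + pℤ`, whose weighted norm `∑ᵢ |aᵢ| e^{w |p nᵢ + s|}` is at most `B`. The index type is arbitrary
and frequencies may repeat, so that sums and products need no collecting of terms. -/
def HasExpSeries (p : ℕ) (w : ℝ) (f : ℝ → ℂ) (s B : ℝ) : Prop :=
  ∃ (ι : Type) (_ : Countable ι) (a : ι → ℂ) (n : ι → ℤ) (b : ℝ),
    HasSum (fun i => ‖a i‖ * Real.exp (w * |p * n i + s|)) b ∧ b ≤ B ∧
    ∀ k : ℝ, HasSum (fun i => a i * Complex.exp (-(Complex.I * (k * (p * n i + s) : ℝ)))) (f k)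

theorem norm_exp_neg_I_mul (x : ℝ) : ‖Complex.exp (-(Complex.I * (x : ℝ)))‖ = 1 := by
  rw [Complex.norm_exp]; simp

namespace HasExpSeries

variable {p : ℕ} {w : ℝ}

theorem nonneg {f : ℝ → ℂ} {s B : ℝ} (h : HasExpSeries p w f s B) : 0 ≤ B := by
  obtain ⟨ι, _, a, n, b, hb, hB, -⟩ := h
  exact (hb.nonneg fun i => by positivity).trans hB

theorem mono {f : ℝ → ℂ} {s B B' : ℝ} (h : HasExpSeries p w f s B) (hB : B ≤ B') :
    HasExpSeries p w f s B' := by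
  obtain ⟨ι, hι, a, n, b, hb, hB', hf⟩ := h
  exact ⟨ι, hι, a, n, b, hb, hB'.trans hB, hf⟩

theorem norm_le (hw : 0 ≤ w) {f : ℝ → ℂ} {s B : ℝ} (h : HasExpSeries p w f s B) (k : ℝ) :
    ‖f k‖ ≤ B := by
  obtain ⟨ι, hι, a, n, b, hb, hB, hf⟩ := h
  rw [← (hf k).tsum_eq]
  refine (tsum_of_norm_bounded hb fun i => ?_).trans hB
  rw [norm_mul, norm_exp_neg_I_mul]
  gcongr
  exact Real.one_le_exp (by positivity)

theorem zero (s : ℝ) : HasExpSeries p w (fun _ => 0) s 0 :=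
  ⟨Empty, inferInstance, fun _ => 0, fun _ => 0, 0, by simp, le_rfl, by simp⟩

theorem const (c : ℂ) : HasExpSeries p w (fun _ => c) 0 ‖c‖ :=
  ⟨Unit, inferInstance, fun _ => c, fun _ => 0, ‖c‖, by simp, le_rfl, by simp⟩

theorem add {f f' : ℝ → ℂ} {s B B' : ℝ} (h : HasExpSeries p w f s B)
    (h' : HasExpSeries p w f' s B') : HasExpSeries p w (fun k => f k + f' k) s (B + B') := by
  obtain ⟨ι, _, a, n, b, hb, hB, hf⟩ := h
  obtain ⟨ι', _, a', n', b', hb', hB', hf'⟩ := h'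
  exact ⟨ι ⊕ ι', inferInstance, Sum.elim a a', Sum.elim n n', b + b', HasSum.sum hb hb',
    add_le_add hB hB', fun k => HasSum.sum (hf k) (hf' k)⟩

theorem sum {T : Type*} (t : Finset T) {f : T → ℝ → ℂ} {s : ℝ} {B : T → ℝ}
    (h : ∀ i ∈ t, HasExpSeries p w (f i) s (B i)) :
    HasExpSeries p w (fun k => ∑ i ∈ t, f i k) s (∑ i ∈ t, B i) := by
  classical
  induction t using Finset.induction_on with
  | empty => simpa using zero s
  | insert i t hi ih =>
    simp only [Finset.sum_insert hi]
    exact (h i (Finset.mem_insert_self i t)).add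
      (ih fun j hj => h j (Finset.mem_insert_of_mem hj))

theorem const_mul {f : ℝ → ℂ} {s B : ℝ} (c : ℂ) (h : HasExpSeries p w f s B) :
    HasExpSeries p w (fun k => c * f k) s (‖c‖ * B) := by
  obtain ⟨ι, hι, a, n, b, hb, hB, hf⟩ := h
  refine ⟨ι, hι, fun i => c * a i, n, ‖c‖ * b, ?_, by gcongr, fun k => ?_⟩
  · simpa only [norm_mul, mul_assoc] using hb.mul_left ‖c‖
  · simpa only [mul_assoc] using (hf k).mul_left c

/-- The weighted norm is submultiplicative, because `|x + x'| ≤ |x| + |x'|` for frequencies. -/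
theorem mul (hw : 0 ≤ w) {f f' : ℝ → ℂ} {s s' B B' : ℝ} (h : HasExpSeries p w f s B)
    (h' : HasExpSeries p w f' s' B') :
    HasExpSeries p w (fun k => f k * f' k) (s + s') (B * B') := by
  have hB0 := h.nonneg
  obtain ⟨ι, _, a, n, b, hb, hB, hf⟩ := h
  obtain ⟨ι', _, a', n', b', hb', hB', hf'⟩ := h'
  have hb0' : 0 ≤ b' := hb'.nonneg fun i => by positivity
  have hn : ∀ k, Summable fun i => ‖a i * Complex.exp (-(Complex.I * (k * (p * n i + s) : ℝ)))‖ :=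
    fun k => hb.summable.of_nonneg_of_le (fun i => norm_nonneg _) fun i => by
      rw [norm_mul, norm_exp_neg_I_mul]
      gcongr
      exact Real.one_le_exp (by positivity)
  have hn' : ∀ k, Summable fun i =>
      ‖a' i * Complex.exp (-(Complex.I * (k * (p * n' i + s') : ℝ)))‖ :=
    fun k => hb'.summable.of_nonneg_of_le (fun i => norm_nonneg _) fun i => by
      rw [norm_mul, norm_exp_neg_I_mul]
      gcongr
      exact Real.one_le_exp (by positivity)
  have hprod := hb.summable.mul_of_nonneg hb'.summable (fun i => by positivity)
    (fun i => by positivity)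
  have hle : ∀ x : ι × ι', ‖a x.1 * a' x.2‖ * Real.exp (w * |p * (n x.1 + n' x.2 : ℤ) + (s + s')|) ≤
      ‖a x.1‖ * Real.exp (w * |p * n x.1 + s|) *
        (‖a' x.2‖ * Real.exp (w * |p * n' x.2 + s'|)) := by
    intro x
    rw [norm_mul, mul_mul_mul_comm, ← Real.exp_add, ← mul_add]
    gcongr
    refine le_trans (le_of_eq ?_) (abs_add_le _ _)
    congr 1; push_cast; ring
  have hs := hprod.of_nonneg_of_le (fun x => by positivity) hle
  refine ⟨ι × ι', inferInstance, fun x => a x.1 * a' x.2, fun x => n x.1 + n' x.2, _,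
    hs.hasSum, ?_, fun k => ?_⟩
  · refine (hs.tsum_le_tsum hle hprod).trans ?_
    rw [(hb.mul hb' hprod).tsum_eq]
    exact mul_le_mul hB hB' hb0' hB0
  · have hs' := summable_mul_of_summable_norm (hn k) (hn' k)
    have he : ∀ x : ι × ι', a x.1 * a' x.2 *
        Complex.exp (-(Complex.I * (k * (p * (n x.1 + n' x.2 : ℤ) + (s + s')) : ℝ))) =
        a x.1 * Complex.exp (-(Complex.I * (k * (p * n x.1 + s) : ℝ))) *
        (a' x.2 * Complex.exp (-(Complex.I * (k * (p * n' x.2 + s') : ℝ)))) := by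
      intro x
      rw [mul_mul_mul_comm, ← Complex.exp_add]
      congr 2
      push_cast; ring
    have h0 : HasSum _ _ := (hf k).mul (hf' k) hs'
    simp only [he]
    convert h0 using 1

end HasExpSeries

/-! ### The trapezoidal rule -/

theorem integral_exp_zone {p : ℕ} (hp : 0 < p) (n : ℤ) (hn : n ≠ 0) :
    ∫ k in (0 : ℝ)..(2 * π / p), Complex.exp (-(Complex.I * (k * (p * n + 0) : ℝ))) = 0 := by
  have hp' : (p : ℂ) ≠ 0 := by exact_mod_cast hp.ne'
  have hn' : (n : ℂ) ≠ 0 := by exact_mod_cast hn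
  have hc : -(Complex.I * (p * n)) ≠ 0 := by
    simp [hp', hn', Complex.I_ne_zero]
  have h1 : ∀ k : ℝ, Complex.exp (-(Complex.I * (k * (p * n + 0) : ℝ))) =
      Complex.exp (-(Complex.I * (p * n)) * k) := by
    intro k; congr 1; push_cast; ring
  simp only [h1]
  rw [integral_exp_mul_complex hc]
  have h2 : Complex.exp (-(Complex.I * (p * n)) * ((2 * π / p : ℝ) : ℂ)) = 1 := by
    rw [Complex.exp_eq_one_iff]
    refine ⟨-n, ?_⟩
    push_cast
    field_simp
  rw [h2, Complex.ofReal_zero, mul_zero, Complex.exp_zero, sub_self, zero_div]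

theorem sum_exp_grid {p M : ℕ} (hp : 0 < p) (hM : 0 < M) (n : ℤ) (hn : ¬ (M : ℤ) ∣ n) :
    ∑ i ∈ Finset.Icc 1 M,
      Complex.exp (-(Complex.I * (2 * π * i / (p * M) * (p * n + 0) : ℝ))) = 0 := by
  have hp' : (p : ℂ) ≠ 0 := by exact_mod_cast hp.ne'
  have hM' : (M : ℂ) ≠ 0 := by exact_mod_cast hM.ne'
  set z := Complex.exp (-(Complex.I * (2 * π * n / M))) with hz
  have h1 : ∀ i : ℕ, Complex.exp (-(Complex.I * (2 * π * i / (p * M) * (p * n + 0) : ℝ))) =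
      z ^ i := by
    intro i
    rw [hz, ← Complex.exp_nat_mul]
    congr 1; push_cast; field_simp; ring
  have hzM : z ^ M = 1 := by
    rw [hz, ← Complex.exp_nat_mul, Complex.exp_eq_one_iff]
    refine ⟨-n, ?_⟩
    push_cast; field_simp
  have hz1 : z ≠ 1 := by
    rw [hz, Ne, Complex.exp_eq_one_iff]
    rintro ⟨l, hl⟩
    apply hn
    refine ⟨-l, ?_⟩
    have h2 : (2 * π * Complex.I : ℂ) ≠ 0 := Complex.two_pi_I_ne_zero
    have h3 : (2 * π * Complex.I : ℂ) * (n : ℂ) = (2 * π * Complex.I : ℂ) * (M * (-l)) := by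
      have : -(Complex.I * (2 * π * n / M)) * M = l * (2 * π * Complex.I) * M := by rw [hl]
      field_simp at this
      linear_combination (-2 * π * Complex.I) * this
    exact_mod_cast mul_left_cancel₀ h2 h3
  simp only [h1]
  rw [← Finset.Ico_succ_right_eq_Icc, Nat.succ_eq_succ, geom_sum_Ico hz1 (by simp)]
  simp [pow_succ, hzM]

/-- The trapezoidal rule integrates `e^{-ipnk}` exactly over a Brillouin zone unless `n` is a
non-zero multiple of `M`. -/
theorem norm_trapezoid_exp_le {p M : ℕ} {w : ℝ} (hw : 0 ≤ w) (hp : 0 < p) (hM : 0 < M) (n : ℤ) :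
    ‖(∫ k in (0 : ℝ)..(2 * π / p), Complex.exp (-(Complex.I * (k * (p * n + 0) : ℝ)))) -
      ∑ i ∈ Finset.Icc 1 M,
        Complex.exp (-(Complex.I * (2 * π * i / (p * M) * (p * n + 0) : ℝ))) *
          ((2 * π / (p * M) : ℝ) : ℂ)‖ ≤
      2 * π / p * Real.exp (-(w * p * M)) * Real.exp (w * |(p : ℝ) * n + 0|) := by
  have hp' : (p : ℂ) ≠ 0 := by exact_mod_cast hp.ne'
  have hM' : (M : ℂ) ≠ 0 := by exact_mod_cast hM.ne'
  have hM'' : (M : ℝ) ≠ 0 := by exact_mod_cast hM.ne'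
  rw [← Finset.sum_mul]
  rcases eq_or_ne n 0 with rfl | hn
  · have : (2 * π / p : ℂ) - M * (2 * π / (p * M)) = 0 := by field_simp; ring
    simp [this]
    positivity
  rw [integral_exp_zone hp n hn, zero_sub, norm_neg]
  by_cases hd : (M : ℤ) ∣ n
  · rw [norm_mul, Complex.norm_real, Real.norm_of_nonneg (by positivity)]
    have h1 : ‖∑ i ∈ Finset.Icc 1 M,
        Complex.exp (-(Complex.I * (2 * π * i / (p * M) * (p * n + 0) : ℝ)))‖ ≤ M := by
      refine (norm_sum_le _ _).trans ?_
      simp only [norm_exp_neg_I_mul]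
      simp
    have hMn : (M : ℝ) ≤ |(n : ℝ)| := by
      have h := Int.le_of_dvd (abs_pos.mpr hn) ((dvd_abs _ _).mpr hd)
      exact_mod_cast h
    rw [mul_assoc _ (Real.exp _), ← Real.exp_add]
    have h2 : 1 ≤ Real.exp (-(w * p * M) + w * |(p : ℝ) * n + 0|) := by
      apply Real.one_le_exp
      rw [add_zero, abs_mul, Nat.abs_cast]
      have : w * p * M ≤ w * p * |(n : ℝ)| := by gcongr
      linarith
    calc _ ≤ (M : ℝ) * (2 * π / (p * M)) := by gcongr
      _ = 2 * π / p * 1 := by field_simp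
      _ ≤ _ := by gcongr
  · rw [sum_exp_grid hp hM n hd]
    simp
    positivity

/-- Exponential convergence of the trapezoidal rule with `M` nodes: of the exponentials
`e^{-ipnk}` in the series of `f`, only those with `|n| ≥ M` contribute to the error. -/
theorem HasExpSeries.norm_trapezoid_le {p M : ℕ} {w : ℝ} (hw : 0 ≤ w) (hp : 0 < p) (hM : 0 < M)
    {f : ℝ → ℂ} {B : ℝ} (h : HasExpSeries p w f 0 B) :
    ‖(∫ k in (0 : ℝ)..(2 * π / p), f k) -
      ∑ i ∈ Finset.Icc 1 M, f (2 * π * i / (p * M)) * ((2 * π / (p * M) : ℝ) : ℂ)‖ ≤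
      2 * π / p * Real.exp (-(w * p * M)) * B := by
  obtain ⟨ι, _, a, n, b, hb, hB, hf⟩ := h
  have hint : HasSum (fun i => ∫ k in (0 : ℝ)..(2 * π / p),
      a i * Complex.exp (-(Complex.I * (k * (p * n i + 0) : ℝ))))
      (∫ k in (0 : ℝ)..(2 * π / p), f k) := by
    refine intervalIntegral.hasSum_integral_of_dominated_convergence
      (bound := fun i _ => ‖a i‖ * Real.exp (w * |(p : ℝ) * n i + 0|)) (fun i => ?_) (fun i => ?_) ?_ ?_ ?_
    · exact (by fun_prop : Continuous fun k : ℝ =>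
        a i * Complex.exp (-(Complex.I * (k * (p * n i + 0) : ℝ)))).aestronglyMeasurable
    · refine Filter.Eventually.of_forall fun k _ => ?_
      rw [norm_mul, norm_exp_neg_I_mul]
      gcongr
      exact Real.one_le_exp (by positivity)
    · exact Filter.Eventually.of_forall fun k _ => hb.summable
    · simp
    · exact Filter.Eventually.of_forall fun k _ => hf k
  have hsum := hasSum_sum (s := Finset.Icc 1 M) fun i _ =>
    (hf (2 * π * i / (p * M))).mul_right ((2 * π / (p * M) : ℝ) : ℂ)
  have herr := hint.sub hsum
  rw [← herr.tsum_eq]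
  refine (tsum_of_norm_bounded (hb.mul_left (2 * π / p * Real.exp (-(w * p * M))))
    fun j => ?_).trans (by gcongr)
  have h1 := norm_trapezoid_exp_le hw hp hM (n j)
  rw [intervalIntegral.integral_const_mul]
  simp only [mul_assoc (a j)]
  rw [← Finset.mul_sum, ← mul_sub, norm_mul]
  calc _ ≤ ‖a j‖ * _ := mul_le_mul_of_nonneg_left h1 (norm_nonneg _)
    _ = _ := by ring

/-! ### Matrices of exponential series -/

/-- The `(α, β)` entry of `A` is an exponential series with frequencies in `τ α - τ β + pℤ`, and the
weighted norms of the entries in each column add up to at most `C`. -/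
def HasExpSeriesMatrix {S : Type*} [Fintype S] (p : ℕ) (w : ℝ) (τ : S → ℝ)
    (A : ℝ → Matrix S S ℂ) (C : ℝ) : Prop :=
  ∃ B : S → S → ℝ, (∀ α β, HasExpSeries p w (fun k => A k α β) (τ α - τ β) (B α β)) ∧
    ∀ β, ∑ α, B α β ≤ C

namespace HasExpSeriesMatrix

variable {S : Type*} [Fintype S] {p : ℕ} {w : ℝ} {τ : S → ℝ}

theorem entry {A : ℝ → Matrix S S ℂ} {C : ℝ} (h : HasExpSeriesMatrix p w τ A C) (α β : S) :
    HasExpSeries p w (fun k => A k α β) (τ α - τ β) C := by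
  obtain ⟨B, hB, hC⟩ := h
  exact (hB α β).mono ((Finset.single_le_sum (f := fun α => B α β)
    (fun i _ => (hB i β).nonneg) (Finset.mem_univ α)).trans (hC β))

theorem add {A A' : ℝ → Matrix S S ℂ} {C C' : ℝ} (h : HasExpSeriesMatrix p w τ A C)
    (h' : HasExpSeriesMatrix p w τ A' C') :
    HasExpSeriesMatrix p w τ (fun k => A k + A' k) (C + C') := by
  obtain ⟨B, hB, hC⟩ := h
  obtain ⟨B', hB', hC'⟩ := h'
  refine ⟨fun α β => B α β + B' α β, fun α β => (hB α β).add (hB' α β), fun β => ?_⟩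
  rw [Finset.sum_add_distrib]
  exact add_le_add (hC β) (hC' β)

theorem zero : HasExpSeriesMatrix p w τ (fun _ => 0) 0 :=
  ⟨fun _ _ => 0, fun _ _ => HasExpSeries.zero _, by simp⟩

theorem sum {T : Type*} (t : Finset T) {A : T → ℝ → Matrix S S ℂ} {C : T → ℝ}
    (h : ∀ i ∈ t, HasExpSeriesMatrix p w τ (A i) (C i)) :
    HasExpSeriesMatrix p w τ (fun k => ∑ i ∈ t, A i k) (∑ i ∈ t, C i) := by
  classical
  induction t using Finset.induction_on with
  | empty => simpa using zero
  | insert i t hi ih =>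
    simp only [Finset.sum_insert hi]
    exact (h i (Finset.mem_insert_self i t)).add
      (ih fun j hj => h j (Finset.mem_insert_of_mem hj))

theorem const_smul {A : ℝ → Matrix S S ℂ} {C : ℝ} (c : ℂ) (h : HasExpSeriesMatrix p w τ A C) :
    HasExpSeriesMatrix p w τ (fun k => c • A k) (‖c‖ * C) := by
  obtain ⟨B, hB, hC⟩ := h
  refine ⟨fun α β => ‖c‖ * B α β, fun α β => (hB α β).const_mul c, fun β => ?_⟩
  rw [← Finset.mul_sum]
  exact mul_le_mul_of_nonneg_left (hC β) (norm_nonneg c)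

theorem one [DecidableEq S] : HasExpSeriesMatrix p w τ (fun _ => 1) 1 := by
  refine ⟨fun α β => if α = β then 1 else 0, fun α β => ?_, by simp⟩
  by_cases h : α = β
  · subst h
    simpa using HasExpSeries.const (p := p) (w := w) 1
  · simpa [h] using HasExpSeries.zero (p := p) (w := w) (τ α - τ β)

theorem mul (hw : 0 ≤ w) {A A' : ℝ → Matrix S S ℂ} {C C' : ℝ}
    (h : HasExpSeriesMatrix p w τ A C) (h' : HasExpSeriesMatrix p w τ A' C') :
    HasExpSeriesMatrix p w τ (fun k => A k * A' k) (C * C') := by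
  obtain ⟨B, hB, hC⟩ := h
  obtain ⟨B', hB', hC'⟩ := h'
  refine ⟨fun α β => ∑ i, B α i * B' i β, fun α β => ?_, fun β => ?_⟩
  · have h1 : ∀ i, HasExpSeries p w (fun k => A k α i * A' k i β) (τ α - τ β)
        (B α i * B' i β) := fun i => by
      simpa using (hB α i).mul hw (hB' i β)
    exact HasExpSeries.sum _ fun i _ => h1 i
  · have hC0 : 0 ≤ C := (Finset.sum_nonneg fun α _ => (hB α β).nonneg).trans (hC β)
    rw [Finset.sum_comm]
    calc ∑ i, ∑ α, B α i * B' i β = ∑ i, (∑ α, B α i) * B' i β := by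
          simp only [Finset.sum_mul]
      _ ≤ ∑ i, C * B' i β := Finset.sum_le_sum fun i _ =>
          mul_le_mul_of_nonneg_right (hC i) (hB' i β).nonneg
      _ = C * ∑ i, B' i β := by rw [Finset.mul_sum]
      _ ≤ C * C' := mul_le_mul_of_nonneg_left (hC' β) hC0

theorem pow [DecidableEq S] (hw : 0 ≤ w) {A : ℝ → Matrix S S ℂ} {C : ℝ}
    (h : HasExpSeriesMatrix p w τ A C) (n : ℕ) :
    HasExpSeriesMatrix p w τ (fun k => A k ^ n) (C ^ n) := by
  induction n with
  | zero => simpa using one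
  | succ n ih => simpa only [pow_succ] using ih.mul hw h

/-- The bound depends on `g`, `E` and `C` only, not on the matrix or its size. -/
theorem shiftedPoly [DecidableEq S] (hw : 0 ≤ w) {A : ℝ → Matrix S S ℂ} {C : ℝ}
    (h : HasExpSeriesMatrix p w τ A C) (g : Polynomial ℝ) (E : ℝ) :
    HasExpSeriesMatrix p w τ (fun k => CoupledChain.shiftedPoly g (A k) E)
      (∑ i ∈ Finset.range (g.natDegree + 1), |g.coeff i| * (C + |E|) ^ i) := by
  have h1 : HasExpSeriesMatrix p w τ (fun k => A k - (E : ℂ) • (1 : Matrix S S ℂ)) (C + |E|) := by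
    have := h.add (one.const_smul (-(E : ℂ)))
    simpa [sub_eq_add_neg] using this
  have h2 := sum (Finset.range (g.natDegree + 1)) fun i _ =>
    (h1.pow hw i).const_smul ((g.coeff i : ℝ) : ℂ)
  simp only [CoupledChain.shiftedPoly, Polynomial.aeval_eq_sum_range]
  simpa only [Complex.norm_real, Real.norm_eq_abs, Complex.coe_smul] using h2

end HasExpSeriesMatrix

/-! ### Polynomials of nearby matrices -/

/-- A polynomial is bounded and Lipschitz on bounded sets of a normed algebra. -/
theorem exists_lipschitz_aeval {R : Type*} [NormedRing R] [NormedAlgebra ℝ R] (g : Polynomial ℝ)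
    (K : ℝ) (hK : 0 ≤ K) :
    ∃ L, 0 ≤ L ∧ ∀ a a' : R, ‖a‖ ≤ K → ‖a'‖ ≤ K → ‖Polynomial.aeval a g‖ ≤ L ∧
      ‖Polynomial.aeval a g - Polynomial.aeval a' g‖ ≤ L * ‖a - a'‖ := by
  induction g using Polynomial.induction_on with
  | C c =>
    refine ⟨‖algebraMap ℝ R c‖, norm_nonneg _, fun a a' _ _ => ?_⟩
    simp only [Polynomial.aeval_C, sub_self, norm_zero]
    exact ⟨le_rfl, by positivity⟩
  | add f g hf hg =>
    obtain ⟨L, hL, h⟩ := hf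
    obtain ⟨L', hL', h'⟩ := hg
    refine ⟨L + L', by positivity, fun a a' ha ha' => ?_⟩
    obtain ⟨h1, h2⟩ := h a a' ha ha'
    obtain ⟨h1', h2'⟩ := h' a a' ha ha'
    simp only [map_add]
    refine ⟨(norm_add_le _ _).trans (add_le_add h1 h1'), ?_⟩
    rw [add_sub_add_comm, add_mul]
    exact (norm_add_le _ _).trans (add_le_add h2 h2')
  | monomial n c ih =>
    obtain ⟨L, hL, h⟩ := ih
    refine ⟨L * K + L, by positivity, fun a a' ha ha' => ?_⟩
    obtain ⟨h1, h2⟩ := h a a' ha ha'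
    have h1' := (h a' a ha' ha).1
    have e : ∀ x : R, Polynomial.aeval x (Polynomial.C c * Polynomial.X ^ (n + 1)) =
        Polynomial.aeval x (Polynomial.C c * Polynomial.X ^ n) * x := by
      intro x
      simp [pow_succ, mul_assoc]
    rw [e a, e a']
    set P := Polynomial.aeval a (Polynomial.C c * Polynomial.X ^ n)
    set P' := Polynomial.aeval a' (Polynomial.C c * Polynomial.X ^ n)
    constructor
    · calc _ ≤ ‖P‖ * ‖a‖ := norm_mul_le _ _
        _ ≤ L * K := by gcongr
        _ ≤ _ := by linarith
    · calc ‖P * a - P' * a'‖ = ‖(P - P') * a + P' * (a - a')‖ := by congr 1; noncomm_ring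
        _ ≤ ‖P - P'‖ * ‖a‖ + ‖P'‖ * ‖a - a'‖ :=
          (norm_add_le _ _).trans (add_le_add (norm_mul_le _ _) (norm_mul_le _ _))
        _ ≤ L * ‖a - a'‖ * K + L * ‖a - a'‖ := by gcongr
        _ = _ := by ring

section LinftyNorm

attribute [local instance] Matrix.linftyOpNormedRing Matrix.linftyOpNormedAlgebra

theorem norm_entry_le_linfty {S : Type*} [Fintype S] [DecidableEq S] (A : Matrix S S ℂ)
    (α β : S) : ‖A α β‖ ≤ ‖A‖ := by
  rw [Matrix.linfty_opNorm_def]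
  have h1 : ‖A α β‖₊ ≤ ∑ j, ‖A α j‖₊ :=
    Finset.single_le_sum (f := fun j => ‖A α j‖₊) (fun _ _ => zero_le) (Finset.mem_univ β)
  have h2 := Finset.le_sup (f := fun i => ∑ j, ‖A i j‖₊) (Finset.mem_univ α)
  exact_mod_cast h1.trans h2

theorem linfty_norm_le {S : Type*} [Fintype S] [DecidableEq S] (A : Matrix S S ℂ) {K : ℝ}
    (hK : 0 ≤ K) (h : ∀ α β, ‖A α β‖ ≤ K) : ‖A‖ ≤ Fintype.card S * K := by
  rw [Matrix.linfty_opNorm_def]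
  lift K to NNReal using hK
  have : (Finset.univ.sup fun i => ∑ j, ‖A i j‖₊) ≤ Fintype.card S * K := by
    refine Finset.sup_le fun i _ => ?_
    refine (Finset.sum_le_card_nsmul _ _ K fun j _ => by exact_mod_cast h i j).trans ?_
    simp
  exact_mod_cast this

/-- If the entries of `A` and `A'` are bounded by `K`, then an entrywise difference of at most `δ`
changes the entries of `g(A - E)` by `O(δ)`. -/
theorem exists_lipschitz_shiftedPoly (S : Type*) [Fintype S] [DecidableEq S] (g : Polynomial ℝ)
    (E K : ℝ) (hK : 0 ≤ K) :
    ∃ L, 0 ≤ L ∧ ∀ (A A' : Matrix S S ℂ) (δ : ℝ), 0 ≤ δ → (∀ α β, ‖A α β‖ ≤ K) →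
      (∀ α β, ‖A' α β‖ ≤ K) → (∀ α β, ‖A α β - A' α β‖ ≤ δ) →
      ∀ α β, ‖shiftedPoly g A E α β - shiftedPoly g A' E α β‖ ≤ L * δ := by
  obtain ⟨L, hL, h⟩ := exists_lipschitz_aeval (R := Matrix S S ℂ) g
    (Fintype.card S * K + ‖(E : ℂ) • (1 : Matrix S S ℂ)‖) (by positivity)
  refine ⟨L * Fintype.card S, by positivity, fun A A' δ hδ hA hA' hd α β => ?_⟩
  have hb : ∀ A : Matrix S S ℂ, (∀ α β, ‖A α β‖ ≤ K) →
      ‖A - (E : ℂ) • (1 : Matrix S S ℂ)‖ ≤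
        Fintype.card S * K + ‖(E : ℂ) • (1 : Matrix S S ℂ)‖ := fun A hA =>
    (norm_sub_le _ _).trans (add_le_add (linfty_norm_le A hK hA) le_rfl)
  have h2 := (h _ _ (hb A hA) (hb A' hA')).2
  rw [sub_sub_sub_cancel_right] at h2
  rw [← Matrix.sub_apply]
  calc _ ≤ ‖shiftedPoly g A E - shiftedPoly g A' E‖ := norm_entry_le_linfty _ _ _
    _ ≤ L * ‖A - A'‖ := h2
    _ ≤ L * (Fintype.card S * δ) := by
      gcongr
      exact linfty_norm_le _ hδ hd
    _ = _ := by ring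

end LinftyNorm

/-! ### Decay of the Hamiltonian in real space -/

/-- Position `R + τ_α` of an orbital, without the shift `d` of chain 2. -/
noncomputable def sitePosition {A₁ A₂ : Type*} (τ₁ : A₁ → ℝ) (τ₂ : A₂ → ℝ) (θ : ℝ) :
    Site A₁ A₂ → ℝ
  | .inl (n, α) => n + τ₁ α
  | .inr (n, α) => n * (1 - θ) + τ₂ α

theorem sitePosition_relabel {A₁ A₂ : Type*} (τ₁ : A₁ → ℝ) (τ₂ : A₂ → ℝ) {θ : ℝ} {p q : ℕ}
    (hpq : (q : ℝ) * (1 - θ) = p) (x : ℤ × SuperIdx p q A₁ A₂) :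
    sitePosition τ₁ τ₂ θ (relabel x) = p * x.1 + superShift τ₁ τ₂ θ x.2 := by
  rcases x with ⟨n, ⟨j, α⟩ | ⟨j, α⟩⟩
  · simp only [relabel, sitePosition, superShift]
    push_cast; ring
  · simp only [relabel, sitePosition, superShift]
    push_cast; linear_combination (n : ℝ) * hpq

theorem eq_of_mul_add_fin_eq {r : ℕ} {n n' : ℤ} {j j' : Fin r}
    (h : n * r + (j : ℕ) = n' * r + (j' : ℕ)) : n = n' ∧ j = j' := by
  have hj : ((j : ℕ) : ℤ) < r := by exact_mod_cast j.2
  have hj' : ((j' : ℕ) : ℤ) < r := by exact_mod_cast j'.2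
  have hr : (0 : ℤ) < r := by omega
  have hn : n = n' := by
    have h1 := congrArg (· / (r : ℤ)) h
    simpa [add_comm (_ * (r : ℤ)), Int.add_mul_ediv_right _ _ hr.ne', Int.ediv_eq_zero_of_lt,
      hj, hj'] using h1
  subst hn
  exact ⟨rfl, Fin.ext (by omega)⟩

theorem relabel_injective {p q : ℕ} {A₁ A₂ : Type*} :
    Function.Injective (relabel : ℤ × SuperIdx p q A₁ A₂ → Site A₁ A₂) := by
  rintro ⟨n, ⟨j, α⟩ | ⟨j, α⟩⟩ ⟨n', ⟨j', α'⟩ | ⟨j', α'⟩⟩ h <;>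
    simp only [relabel, Sum.inl.injEq, Sum.inr.injEq, Prod.mk.injEq, reduceCtorEq] at h
  all_goals
    obtain ⟨rfl, rfl⟩ := eq_of_mul_add_fin_eq h.1
    rw [h.2]

theorem abs_intra_le {A : Type*} {t ε : A → A → ℝ} {T : ℝ} (ht : ∀ α β, |t α β| ≤ T)
    (hε : ∀ α β, |ε α β| ≤ T) {γ a b : ℝ} (hγ : 0 < γ) (ha : 0 ≤ a) (hab : a ≤ b) {τ : A → ℝ}
    (hτ : ∀ α, τ α ∈ Set.Icc 0 a) (n : ℤ) (α β : A) :
    |intra t ε n α β| ≤ T * Real.exp (2 * γ * b) * Real.exp (-γ * |n * a + τ α - τ β|) := by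
  have hT : 0 ≤ T := (abs_nonneg _).trans (ht α β)
  have key : ∀ n : ℤ, |n| ≤ 1 →
      T ≤ T * Real.exp (2 * γ * b) * Real.exp (-γ * |n * a + τ α - τ β|) := by
    intro n hn
    rw [mul_assoc, ← Real.exp_add]
    refine le_mul_of_one_le_right hT (Real.one_le_exp ?_)
    have hn' : |(n : ℝ)| ≤ 1 := by exact_mod_cast hn
    have h1 : |n * a + τ α - τ β| ≤ 2 * b := by
      have hα := hτ α
      have hβ := hτ β
      obtain ⟨h3, h4⟩ := abs_le.mp hn'
      rw [abs_le]
      constructor <;> nlinarith [hα.1, hα.2, hβ.1, hβ.2]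
    nlinarith
  unfold intra
  split_ifs with h1 h2 h3
  · exact (ht _ _).trans (key n (by simp [h1]))
  · exact (ht _ _).trans (key n (by simp [h2]))
  · exact (hε _ _).trans (key n (by simp [h3]))
  · rw [abs_zero]; positivity

theorem exp_neg_mul_abs_shift_le {γ : ℝ} (hγ : 0 < γ) (d u v : ℝ) (h : |v| ≤ |u| + |d|) :
    Real.exp (-γ * |u|) ≤ Real.exp (γ * |d|) * Real.exp (-γ * |v|) := by
  rw [← Real.exp_add]
  gcongr
  nlinarith

theorem abs_le_sum_abs {A : Type*} [Fintype A] (f : A → A → ℝ) (α β : A) :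
    |f α β| ≤ ∑ x, ∑ y, |f x y| :=
  (Finset.single_le_sum (f := fun y => |f α y|) (fun _ _ => abs_nonneg _)
    (Finset.mem_univ β)).trans (Finset.single_le_sum (f := fun x => ∑ y, |f x y|)
      (fun _ _ => Finset.sum_nonneg fun _ _ => abs_nonneg _) (Finset.mem_univ α))

/-- Common bound on all intralayer hopping energies. -/
theorem exists_hopping_bound {A₁ A₂ : Type*} [Fintype A₁] [Fintype A₂] (m : Hopping A₁ A₂) :
    ∃ T : ℝ, 0 ≤ T ∧ (∀ α β, |m.t₁ α β| ≤ T) ∧ (∀ α β, |m.ε₁ α β| ≤ T) ∧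
      (∀ α β, |m.t₂ α β| ≤ T) ∧ (∀ α β, |m.ε₂ α β| ≤ T) := by
  have h₁ : 0 ≤ ∑ x, ∑ y, |m.t₁ x y| := by positivity
  have h₂ : 0 ≤ ∑ x, ∑ y, |m.ε₁ x y| := by positivity
  have h₃ : 0 ≤ ∑ x, ∑ y, |m.t₂ x y| := by positivity
  have h₄ : 0 ≤ ∑ x, ∑ y, |m.ε₂ x y| := by positivity
  refine ⟨(∑ x, ∑ y, |m.t₁ x y|) + (∑ x, ∑ y, |m.ε₁ x y|) + (∑ x, ∑ y, |m.t₂ x y|) +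
    (∑ x, ∑ y, |m.ε₂ x y|), by linarith, fun α β => ?_, fun α β => ?_, fun α β => ?_,
    fun α β => ?_⟩
  · linarith [abs_le_sum_abs m.t₁ α β]
  · linarith [abs_le_sum_abs m.ε₁ α β]
  · linarith [abs_le_sum_abs m.t₂ α β]
  · linarith [abs_le_sum_abs m.ε₂ α β]

/-- `H_{θ,d}` decays like `e^{-γ |x - y|}`, uniformly in the shifts and in `θ ≥ θ₀`. -/
theorem exists_hamiltonian_decay {A₁ A₂ : Type*} [Fintype A₁] [Fintype A₂] (m : Hopping A₁ A₂)
    {h₀ γ : ℝ} (hh₀ : 0 < h₀) (hγ : 0 < γ) (hdecay : ∀ x, |m.h x| ≤ h₀ * Real.exp (-γ * |x|))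
    (d θ₀ : ℝ) :
    ∃ C, 0 ≤ C ∧ ∀ θ : ℝ, θ₀ ≤ θ → θ < 1 → ∀ (τ₁ : A₁ → ℝ) (τ₂ : A₂ → ℝ),
      (∀ α, τ₁ α ∈ Set.Icc 0 1) → (∀ α, τ₂ α ∈ Set.Icc 0 (1 - θ)) → ∀ x y,
      |hamiltonian m τ₁ τ₂ θ d x y| ≤
        C * Real.exp (-γ * |sitePosition τ₁ τ₂ θ x - sitePosition τ₁ τ₂ θ y|) := by
  obtain ⟨T, hT, ht₁, hε₁, ht₂, hε₂⟩ := exists_hopping_bound m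
  set b : ℝ := 1 + |θ₀| with hb
  refine ⟨T * Real.exp (2 * γ * b) + h₀ * Real.exp (γ * |d|), by positivity, ?_⟩
  intro θ hθ hθ1 τ₁ τ₂ hτ₁ hτ₂ x y
  have hb1 : 1 ≤ b := by simp [hb]
  have hbθ : 1 - θ ≤ b := by have := neg_abs_le θ₀; linarith
  have inter : ∀ u v : ℝ, |v| ≤ |u| + |d| → |m.h (|u|)| ≤
      (T * Real.exp (2 * γ * b) + h₀ * Real.exp (γ * |d|)) * Real.exp (-γ * |v|) := by
    intro u v huv
    refine (hdecay _).trans ?_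
    rw [abs_abs, add_mul]
    have h1 := mul_le_mul_of_nonneg_left (exp_neg_mul_abs_shift_le hγ d u v huv) hh₀.le
    have : 0 ≤ T * Real.exp (2 * γ * b) * Real.exp (-γ * |v|) := by positivity
    linarith
  have intra_le : ∀ {u v : ℝ}, u = v → ∀ c, |c| ≤ T * Real.exp (2 * γ * b) * Real.exp (-γ * |u|) →
      |c| ≤ (T * Real.exp (2 * γ * b) + h₀ * Real.exp (γ * |d|)) * Real.exp (-γ * |v|) := by
    rintro u _ rfl c hc
    refine hc.trans ?_
    gcongr
    have : 0 ≤ h₀ * Real.exp (γ * |d|) := by positivity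
    linarith
  rcases x with ⟨n, α⟩ | ⟨n, α⟩ <;> rcases y with ⟨n', α'⟩ | ⟨n', α'⟩ <;>
    simp only [hamiltonian, sitePosition]
  · refine intra_le ?_ _ (abs_intra_le ht₁ hε₁ hγ zero_le_one hb1 hτ₁ _ _ _)
    push_cast; ring
  · refine inter _ _ (le_trans (le_of_eq ?_) (abs_add_le _ d))
    congr 1; ring
  · refine inter _ _ (le_trans (le_of_eq ?_) (abs_sub _ d))
    congr 1; ring
  · refine intra_le ?_ _ (abs_intra_le ht₂ hε₂ hγ (by linarith) hbθ hτ₂ _ _ _)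
    push_cast; ring

/-! ### Lattice sums -/

theorem summable_exp_neg_mul_abs {c : ℝ} (hc : 0 < c) :
    Summable fun n : ℤ => Real.exp (-(c * |(n : ℝ)|)) := by
  have h : Summable fun n : ℕ => Real.exp (-(c * n)) := by
    have h1 := Real.summable_exp_nat_mul_of_ge (c := -c) (by linarith) (f := fun n => n)
      (fun n => le_refl _)
    simpa using h1
  exact Summable.of_nat_of_neg (by simpa using h) (by simpa using h)

/-- Sums of `e^{-w|x|}` over a shifted lattice are bounded uniformly in the shift and in the
lattice constant `a ≥ a₀`: with `r` the integer nearest to `s / a`, `|a n + s| ≥ a |n + r| / 2`. -/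
theorem lattice_sum_le {w a₀ a : ℝ} (hw : 0 < w) (ha₀ : 0 < a₀) (ha : a₀ ≤ a) (s : ℝ) :
    Summable (fun n : ℤ => Real.exp (-(w * |n * a + s|))) ∧
      ∑' n : ℤ, Real.exp (-(w * |n * a + s|)) ≤
        ∑' n : ℤ, Real.exp (-(w * a₀ / 2 * |(n : ℝ)|)) := by
  have ha' : 0 < a := ha₀.trans_le ha
  set r := round (s / a)
  have hle : ∀ n : ℤ, Real.exp (-(w * |n * a + s|)) ≤
      Real.exp (-(w * a₀ / 2 * |((n + r : ℤ) : ℝ)|)) := by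
    intro n
    have h1 : |((n + r : ℤ) : ℝ)| / 2 ≤ |n + s / a| := by
      rcases eq_or_ne (n + r) 0 with h0 | h0
      · rw [h0]; simp
      · have h2 : (1 : ℝ) ≤ |((n + r : ℤ) : ℝ)| := by exact_mod_cast Int.one_le_abs h0
        have h3 := abs_sub_round (s / a)
        have h4 : |((n + r : ℤ) : ℝ)| ≤ |n + s / a| + |s / a - r| := by
          refine le_trans (le_of_eq ?_) (abs_sub _ _)
          congr 1; push_cast; ring
        linarith
    have h5 : |n * a + s| = a * |n + s / a| := by
      rw [← abs_of_pos ha', ← abs_mul, abs_of_pos ha']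
      congr 1; field_simp
    have h6 : a₀ * (|((n + r : ℤ) : ℝ)| / 2) ≤ |n * a + s| := by
      rw [h5]; gcongr
    have h7 := mul_le_mul_of_nonneg_left h6 hw.le
    apply Real.exp_le_exp.mpr
    linarith
  have hs0 := summable_exp_neg_mul_abs (c := w * a₀ / 2) (by positivity)
  have hs := (Equiv.addRight r).summable_iff.mpr hs0
  have hsum : Summable (fun n : ℤ => Real.exp (-(w * |n * a + s|))) :=
    hs.of_nonneg_of_le (fun n => (Real.exp_pos _).le) hle
  refine ⟨hsum, (hsum.tsum_le_tsum hle hs).trans (le_of_eq ?_)⟩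
  exact (Equiv.addRight r).tsum_eq fun n : ℤ => Real.exp (-(w * a₀ / 2 * |(n : ℝ)|))

theorem summable_prod_fintype_of_nonneg {ι A : Type*} [Fintype A] {f : ι × A → ℝ} (hf : 0 ≤ f)
    {Z : ℝ} (hs : ∀ α, Summable fun n => f (n, α)) (h : ∀ α, ∑' n, f (n, α) ≤ Z) :
    Summable f ∧ ∑' x, f x ≤ Fintype.card A * Z := by
  have h1 : HasSum (fun n => ∑ α, f (n, α)) (∑ α, ∑' n, f (n, α)) :=
    hasSum_sum fun α _ => (hs α).hasSum
  have h2 : Summable f := by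
    rw [summable_prod_of_nonneg hf]
    refine ⟨fun n => Summable.of_finite, ?_⟩
    simpa only [tsum_fintype] using h1.summable
  refine ⟨h2, ?_⟩
  have h3 := h2.hasSum.prod_fiberwise fun n => hasSum_fintype fun α => f (n, α)
  rw [← h1.unique h3]
  refine (Finset.sum_le_card_nsmul _ _ Z fun α _ => h α).trans ?_
  simp

/-- The sum of `e^{-w|x - Y|}` over the positions `x` of all orbitals, bounded uniformly in `Y`, in
the shifts and in `θ ≤ θ₁`. -/
theorem exists_site_sum_le (A₁ A₂ : Type*) [Fintype A₁] [Fintype A₂] {w : ℝ} (hw : 0 < w)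
    {θ₁ : ℝ} (hθ₁ : θ₁ < 1) :
    ∃ Z, 0 ≤ Z ∧ ∀ θ : ℝ, θ ≤ θ₁ → ∀ (τ₁ : A₁ → ℝ) (τ₂ : A₂ → ℝ) (Y : ℝ),
      Summable (fun x => Real.exp (-(w * |sitePosition τ₁ τ₂ θ x - Y|))) ∧
      ∑' x, Real.exp (-(w * |sitePosition τ₁ τ₂ θ x - Y|)) ≤ Z := by
  set a₀ : ℝ := min 1 (1 - θ₁)
  have ha₀ : 0 < a₀ := lt_min one_pos (by linarith)
  set Z₀ := ∑' n : ℤ, Real.exp (-(w * a₀ / 2 * |(n : ℝ)|))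
  have hZ₀ : 0 ≤ Z₀ := tsum_nonneg fun n => (Real.exp_pos _).le
  refine ⟨Fintype.card A₁ * Z₀ + Fintype.card A₂ * Z₀, by positivity, ?_⟩
  intro θ hθ τ₁ τ₂ Y
  have h₁ := fun α => lattice_sum_le hw ha₀ (min_le_left _ _ : a₀ ≤ 1) (τ₁ α - Y)
  have h₂ := fun α => lattice_sum_le hw ha₀
    ((min_le_right _ _).trans (by linarith) : a₀ ≤ 1 - θ) (τ₂ α - Y)
  simp only [mul_one, ← add_sub_assoc] at h₁ h₂
  obtain ⟨s₁, b₁⟩ := summable_prod_fintype_of_nonneg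
    (f := fun x : ℤ × A₁ => Real.exp (-(w * |x.1 + τ₁ x.2 - Y|))) (fun x => (Real.exp_pos _).le)
    (fun α => (h₁ α).1) (fun α => (h₁ α).2)
  obtain ⟨s₂, b₂⟩ := summable_prod_fintype_of_nonneg
    (f := fun x : ℤ × A₂ => Real.exp (-(w * |x.1 * (1 - θ) + τ₂ x.2 - Y|)))
    (fun x => (Real.exp_pos _).le) (fun α => (h₂ α).1) (fun α => (h₂ α).2)
  have hs := HasSum.sum (f := fun x : Site A₁ A₂ =>
    Real.exp (-(w * |sitePosition τ₁ τ₂ θ x - Y|))) s₁.hasSum s₂.hasSum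
  exact ⟨hs.summable, hs.tsum_eq.le.trans (add_le_add b₁ b₂)⟩

/-! ### The Bloch Hamiltonian as a matrix of exponential series -/

/-- A kernel with weighted column sums `∑_α ∑_n |K(nα, 0β)| e^{w |pn + τ_α - τ_β|}` at most `C` has a
Bloch matrix with weighted column norms at most `C`. -/
theorem hasExpSeriesMatrix_blochMatrix {S : Type*} [Fintype S] {p : ℕ} {w C : ℝ} {τ : S → ℝ}
    {K : ℤ × S → ℤ × S → ℝ} (hw : 0 ≤ w)
    (hs : ∀ β, Summable fun x : ℤ × S =>
      |K x (0, β)| * Real.exp (w * |p * x.1 + (τ x.2 - τ β)|))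
    (hC : ∀ β, ∑' x : ℤ × S, |K x (0, β)| * Real.exp (w * |p * x.1 + (τ x.2 - τ β)|) ≤ C) :
    HasExpSeriesMatrix p w τ (blochMatrix p τ K) C := by
  have hs' : ∀ α β, Summable fun n : ℤ =>
      |K (n, α) (0, β)| * Real.exp (w * |p * n + (τ α - τ β)|) := fun α β =>
    (hs β).comp_injective (i := fun n : ℤ => (n, α)) fun n n' h => (Prod.ext_iff.mp h).1
  refine ⟨fun α β => ∑' n : ℤ, |K (n, α) (0, β)| * Real.exp (w * |p * n + (τ α - τ β)|),
    fun α β => ?_, fun β => ?_⟩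
  · refine ⟨ℤ, inferInstance, fun n => K (n, α) (0, β), fun n => n, _, ?_, le_rfl, fun k => ?_⟩
    · simpa only [Complex.norm_real, Real.norm_eq_abs] using (hs' α β).hasSum
    · have hsum : Summable fun n : ℤ => (K (n, α) (0, β) : ℂ) *
          Complex.exp (-(Complex.I * (k * (p * n + τ α - τ β) : ℝ))) := by
        refine Summable.of_norm_bounded (hs' α β) fun n => ?_
        rw [norm_mul, norm_exp_neg_I_mul, Complex.norm_real, Real.norm_eq_abs]
        gcongr
        exact Real.one_le_exp (by positivity)
      simpa only [add_sub_assoc, blochMatrix, Matrix.of_apply] using hsum.hasSum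
  · refine le_trans (le_of_eq ?_) (hC β)
    have h1 := hasSum_sum (s := Finset.univ) fun α _ => (hs' α β).hasSum
    exact h1.unique ((hs β).hasSum.prod_fiberwise fun n => hasSum_fintype fun α =>
      |K (n, α) (0, β)| * Real.exp (w * |p * n + (τ α - τ β)|))

/-- The weighted column norms of `H_{θ,d}(k)` and `H_{k,trunc}` are bounded uniformly in the size of
the supercell, the shifts, the truncation and `θ ∈ [θ₀, θ₁]`. -/
theorem exists_hasExpSeriesMatrix {A₁ A₂ : Type*} [Fintype A₁] [Fintype A₂] (m : Hopping A₁ A₂)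
    {h₀ γ : ℝ} (hh₀ : 0 < h₀) (hγ : 0 < γ) (hdecay : ∀ x, |m.h x| ≤ h₀ * Real.exp (-γ * |x|))
    (d θ₀ : ℝ) {θ₁ : ℝ} (hθ₁ : θ₁ < 1) :
    ∃ C, 0 ≤ C ∧ ∀ (θ : ℝ) (p q : ℕ), θ ∈ Set.Icc θ₀ θ₁ → (q : ℝ) * (1 - θ) = p →
      ∀ (τ₁ : A₁ → ℝ) (τ₂ : A₂ → ℝ),
      (∀ α, τ₁ α ∈ Set.Icc 0 1) → (∀ α, τ₂ α ∈ Set.Icc 0 (1 - θ)) →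
      HasExpSeriesMatrix p (γ / 2) (superShift τ₁ τ₂ θ) (blochHamiltonian m τ₁ τ₂ θ d p q) C ∧
      ∀ c : ℕ,
        HasExpSeriesMatrix p (γ / 2) (superShift τ₁ τ₂ θ) (blochTrunc m τ₁ τ₂ θ d p q c) C := by
  obtain ⟨C, hC, hdec⟩ := exists_hamiltonian_decay m hh₀ hγ hdecay d θ₀
  obtain ⟨Z, hZ, hsite⟩ := exists_site_sum_le A₁ A₂ (half_pos hγ) hθ₁
  refine ⟨C * Z, by positivity, ?_⟩
  intro θ p q hθ hpq τ₁ τ₂ hτ₁ hτ₂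
  set τ := superShift (p := p) (q := q) τ₁ τ₂ θ with hτ
  have hpos : ∀ (x : ℤ × SuperIdx p q A₁ A₂) β,
      sitePosition τ₁ τ₂ θ (relabel x) - τ β = p * x.1 + (τ x.2 - τ β) := by
    intro x β
    rw [sitePosition_relabel τ₁ τ₂ hpq]
    ring
  have hs : ∀ β, Summable (fun x : ℤ × SuperIdx p q A₁ A₂ =>
      C * Real.exp (-(γ / 2 * |p * x.1 + (τ x.2 - τ β)|))) ∧
      ∑' x : ℤ × SuperIdx p q A₁ A₂, C * Real.exp (-(γ / 2 * |p * x.1 + (τ x.2 - τ β)|)) ≤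
        C * Z := by
    intro β
    obtain ⟨h1, h2⟩ := hsite θ hθ.2 τ₁ τ₂ (τ β)
    have h3 := tsum_comp_le_tsum_of_inj h1 (fun x => (Real.exp_pos _).le)
      (relabel_injective (p := p) (q := q))
    have h4 := h1.comp_injective (relabel_injective (p := p) (q := q))
    simp only [Function.comp_def, hpos] at h3 h4
    refine ⟨h4.mul_left C, ?_⟩
    rw [tsum_mul_left]
    exact mul_le_mul_of_nonneg_left (h3.trans h2) hC
  have hle : ∀ (x : ℤ × SuperIdx p q A₁ A₂) β,
      |superHamiltonian m τ₁ τ₂ θ d p q x (0, β)| *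
        Real.exp (γ / 2 * |p * x.1 + (τ x.2 - τ β)|) ≤
      C * Real.exp (-(γ / 2 * |p * x.1 + (τ x.2 - τ β)|)) := by
    intro x β
    have h1 := hdec θ hθ.1 (hθ.2.trans_lt hθ₁) τ₁ τ₂ hτ₁ hτ₂ (relabel x) (relabel (0, β))
    have h2 : sitePosition τ₁ τ₂ θ (relabel ((0 : ℤ), β)) = τ β := by
      rw [sitePosition_relabel τ₁ τ₂ hpq]; simp [hτ]
    rw [h2, hpos] at h1
    calc _ ≤ C * Real.exp (-γ * |p * x.1 + (τ x.2 - τ β)|) *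
          Real.exp (γ / 2 * |p * x.1 + (τ x.2 - τ β)|) := by gcongr; exact h1
      _ = _ := by
        rw [mul_assoc, ← Real.exp_add]
        congr 2; ring
  have hmat : ∀ K : ℤ × SuperIdx p q A₁ A₂ → ℤ × SuperIdx p q A₁ A₂ → ℝ,
      (∀ x y, |K x y| ≤ |superHamiltonian m τ₁ τ₂ θ d p q x y|) →
      HasExpSeriesMatrix p (γ / 2) τ (blochMatrix p τ K) (C * Z) := by
    intro K hK
    have hle' : ∀ β (x : ℤ × SuperIdx p q A₁ A₂),
        |K x (0, β)| * Real.exp (γ / 2 * |p * x.1 + (τ x.2 - τ β)|) ≤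
        C * Real.exp (-(γ / 2 * |p * x.1 + (τ x.2 - τ β)|)) := fun β x =>
      (mul_le_mul_of_nonneg_right (hK _ _) (Real.exp_pos _).le).trans (hle x β)
    have hs' := fun β => (hs β).1.of_nonneg_of_le (fun x => by positivity) (hle' β)
    exact hasExpSeriesMatrix_blochMatrix (by positivity) hs' fun β =>
      ((hs' β).tsum_le_tsum (hle' β) (hs β).1).trans (hs β).2
  refine ⟨hmat _ fun x y => le_rfl, fun c => hmat _ fun x y => ?_⟩
  rw [truncHamiltonian]
  split_ifs
  · simp
  · exact le_rfl

/-! ### Truncation -/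

/-- The part `|n| > c` of a geometric sum over `ℤ` is dominated by `e^{-ac}` times two translates of
the full sum, centred at `c` and `-c`. -/
theorem exp_neg_tail_le {a : ℝ} (c : ℕ) (n : ℤ) (h : (c : ℤ) < |n|) :
    Real.exp (-(a * |(n : ℝ)|)) ≤ Real.exp (-(a * c)) *
      (Real.exp (-(a * |((n + c : ℤ) : ℝ)|)) + Real.exp (-(a * |((n - c : ℤ) : ℝ)|))) := by
  rw [mul_add, ← Real.exp_add, ← Real.exp_add, ← neg_add, ← neg_add, ← mul_add, ← mul_add]
  rcases lt_abs.mp h with h | h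
  · have e : (c : ℝ) + |((n - c : ℤ) : ℝ)| = |(n : ℝ)| := by
      have : (c : ℤ) + |n - c| = |n| := by
        rw [abs_of_pos (by omega), abs_of_pos (by omega)]; ring
      exact_mod_cast this
    rw [e]
    exact le_add_of_nonneg_left (Real.exp_pos _).le
  · have e : (c : ℝ) + |((n + c : ℤ) : ℝ)| = |(n : ℝ)| := by
      have : (c : ℤ) + |n + c| = |n| := by
        rw [abs_of_neg (by omega), abs_of_neg (by omega)]; ring
      exact_mod_cast this
    rw [e]
    exact le_add_of_nonneg_right (Real.exp_pos _).le

theorem superShift_mem {A₁ A₂ : Type*} {τ₁ : A₁ → ℝ} {τ₂ : A₂ → ℝ} {θ : ℝ} {p q : ℕ}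
    (hθ : θ < 1) (hpq : (q : ℝ) * (1 - θ) = p) (hτ₁ : ∀ α, τ₁ α ∈ Set.Icc 0 1)
    (hτ₂ : ∀ α, τ₂ α ∈ Set.Icc 0 (1 - θ)) (σ : SuperIdx p q A₁ A₂) :
    superShift τ₁ τ₂ θ σ ∈ Set.Icc (0 : ℝ) p := by
  have hθ' : 0 < 1 - θ := by linarith
  rcases σ with ⟨j, α⟩ | ⟨j, α⟩ <;> simp only [superShift, Set.mem_Icc]
  · have hj : ((j : ℕ) : ℝ) + 1 ≤ p := by exact_mod_cast j.2
    have h := hτ₁ α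
    exact ⟨add_nonneg (by positivity) h.1, by linarith [h.2]⟩
  · have hj : ((j : ℕ) : ℝ) + 1 ≤ q := by exact_mod_cast j.2
    have h := hτ₂ α
    refine ⟨add_nonneg (by positivity) h.1, ?_⟩
    have h1 := mul_le_mul_of_nonneg_right hj hθ'.le
    linarith [h.2]

/-- Truncation beyond `c` supercells changes the entries of `H_{θ,d}(k)` by `O(e^{-γcp})`. -/
theorem exists_blochTrunc_error {A₁ A₂ : Type*} [Fintype A₁] [Fintype A₂] (m : Hopping A₁ A₂)
    {h₀ γ : ℝ} (hh₀ : 0 < h₀) (hγ : 0 < γ) (hdecay : ∀ x, |m.h x| ≤ h₀ * Real.exp (-γ * |x|))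
    (d θ : ℝ) (p q : ℕ) (hp : 0 < p) (hθ : θ < 1) (hpq : (q : ℝ) * (1 - θ) = p) :
    ∃ D, 0 ≤ D ∧ ∀ (τ₁ : A₁ → ℝ) (τ₂ : A₂ → ℝ), (∀ α, τ₁ α ∈ Set.Icc 0 1) →
      (∀ α, τ₂ α ∈ Set.Icc 0 (1 - θ)) → ∀ (c : ℕ) (k : ℝ) (α β : SuperIdx p q A₁ A₂),
      ‖blochHamiltonian m τ₁ τ₂ θ d p q k α β - blochTrunc m τ₁ τ₂ θ d p q c k α β‖ ≤
        D * Real.exp (-γ * c * p) := by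
  obtain ⟨C, hC, hdec⟩ := exists_hamiltonian_decay m hh₀ hγ hdecay d θ
  have hp' : (0 : ℝ) < p := by exact_mod_cast hp
  have ha : 0 < γ * p := by positivity
  have hgeo := summable_exp_neg_mul_abs ha
  set Z := ∑' n : ℤ, Real.exp (-(γ * p * |(n : ℝ)|)) with hZ
  have hZ0 : 0 ≤ Z := tsum_nonneg fun n => (Real.exp_pos _).le
  refine ⟨C * Real.exp (γ * p) * (Z + Z), by positivity, ?_⟩
  intro τ₁ τ₂ hτ₁ hτ₂ c k α β
  set H := superHamiltonian m τ₁ τ₂ θ d p q with hH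
  set H' := truncHamiltonian m τ₁ τ₂ θ d p q c with hH'
  set τ := superShift (p := p) (q := q) τ₁ τ₂ θ with hτ
  have hHle : ∀ n : ℤ, |H (n, α) (0, β)| ≤
      C * Real.exp (γ * p) * Real.exp (-(γ * p * |(n : ℝ)|)) := by
    intro n
    refine (hdec θ le_rfl hθ τ₁ τ₂ hτ₁ hτ₂ (relabel (n, α)) (relabel (0, β))).trans ?_
    rw [sitePosition_relabel τ₁ τ₂ hpq, sitePosition_relabel τ₁ τ₂ hpq, mul_assoc, ← Real.exp_add]
    gcongr
    have h1 := superShift_mem hθ hpq hτ₁ hτ₂ α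
    have h2 := superShift_mem hθ hpq hτ₁ hτ₂ β
    have h3 : |τ α - τ β| ≤ p := by
      rw [abs_le]; constructor <;> linarith [h1.1, h1.2, h2.1, h2.2]
    have h4 : (p : ℝ) * |(n : ℝ)| ≤ |p * n + τ α - (p * (0 : ℤ) + τ β)| + |τ α - τ β| := by
      have h5 := abs_sub (p * n + τ α - (p * (0 : ℤ) + τ β)) (τ α - τ β)
      have h6 : p * n + τ α - (p * (0 : ℤ) + τ β) - (τ α - τ β) = (p : ℝ) * n := by
        push_cast; ring
      rwa [h6, abs_mul, abs_of_pos hp'] at h5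
    simp only [hτ] at h3 h4
    nlinarith
  have hdiff : ∀ n : ℤ, |H (n, α) (0, β) - H' (n, α) (0, β)| ≤
      C * Real.exp (γ * p) * (Real.exp (-(γ * p * c)) *
        (Real.exp (-(γ * p * |((n + c : ℤ) : ℝ)|)) +
          Real.exp (-(γ * p * |((n - c : ℤ) : ℝ)|)))) := by
    intro n
    by_cases hc : (c : ℤ) < |n|
    · have h1 : |H (n, α) (0, β) - H' (n, α) (0, β)| ≤ |H (n, α) (0, β)| := by
        rw [hH', truncHamiltonian]
        split_ifs
        · rw [sub_zero]
        · rw [sub_self, abs_zero]; exact abs_nonneg _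
      refine (h1.trans (hHle n)).trans ?_
      gcongr
      exact exp_neg_tail_le c n hc
    · have h1 : ¬ ((c * p : ℤ) < |(p : ℤ) * n - p * 0|) := by
        rw [mul_zero, sub_zero, abs_mul, Nat.abs_cast, mul_comm (p : ℤ)]
        intro h
        exact hc (lt_of_mul_lt_mul_right h (by positivity))
      have h2 : H' (n, α) (0, β) = H (n, α) (0, β) := by
        rw [hH', truncHamiltonian, if_neg fun h => h1 h.2]
      rw [h2, sub_self, abs_zero]
      positivity
  have hsum := ((((Equiv.addRight (c : ℤ)).hasSum_iff.mpr hgeo.hasSum).add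
    ((Equiv.subRight (c : ℤ)).hasSum_iff.mpr hgeo.hasSum)).mul_left
    (Real.exp (-(γ * p * c)))).mul_left (C * Real.exp (γ * p))
  have hcol : ∀ K : ℤ × SuperIdx p q A₁ A₂ → ℤ × SuperIdx p q A₁ A₂ → ℝ,
      (Summable fun n : ℤ => K (n, α) (0, β)) → Summable fun n : ℤ => (K (n, α) (0, β) : ℂ) *
        Complex.exp (-(Complex.I * (k * (p * n + τ α - τ β) : ℝ))) := fun K hK =>
    Summable.of_norm_bounded hK.abs fun n => by
      rw [norm_mul, norm_exp_neg_I_mul, Complex.norm_real, Real.norm_eq_abs, mul_one]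
  have e1 : blochHamiltonian m τ₁ τ₂ θ d p q k α β - blochTrunc m τ₁ τ₂ θ d p q c k α β =
      ∑' n : ℤ, ((H (n, α) (0, β) - H' (n, α) (0, β) : ℝ) : ℂ) *
        Complex.exp (-(Complex.I * (k * (p * n + τ α - τ β) : ℝ))) := by
    simp only [blochHamiltonian, blochTrunc, blochMatrix, Matrix.of_apply]
    rw [← Summable.tsum_sub
      (hcol H (superHamiltonian_summable m τ₁ τ₂ θ d p q hp hpq h₀ γ hγ hdecay α β))
      (hcol H' (truncHamiltonian_summable m τ₁ τ₂ θ d p q c hp hpq h₀ γ hγ hdecay α β))]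
    refine tsum_congr fun n => ?_
    push_cast; ring
  rw [e1]
  refine (tsum_of_norm_bounded hsum fun n => ?_).trans (le_of_eq ?_)
  · rw [norm_mul, norm_exp_neg_I_mul, mul_one, Complex.norm_real, Real.norm_eq_abs]
    exact hdiff n
  · have : -(γ * p * c) = -γ * c * p := by ring
    rw [this]; ring

/-- For fixed `p` and `q`, truncation changes `g(H_{θ,d}(k) - E)` by `O(e^{-γcp})`, uniformly in `k`
and in the shifts. -/
theorem exists_shiftedPoly_blochTrunc_error {A₁ A₂ : Type*} [Fintype A₁] [Fintype A₂]
    [DecidableEq A₁] [DecidableEq A₂] (m : Hopping A₁ A₂) {h₀ γ : ℝ} (hh₀ : 0 < h₀) (hγ : 0 < γ)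
    (hdecay : ∀ x, |m.h x| ≤ h₀ * Real.exp (-γ * |x|)) (g : Polynomial ℝ) (d E : ℝ) (p q : ℕ) :
    ∃ F, 0 ≤ F ∧ ∀ θ : ℝ, 0 < q → θ < 1 → (q : ℝ) * (1 - θ) = p →
      ∀ (τ₁ : A₁ → ℝ) (τ₂ : A₂ → ℝ), (∀ α, τ₁ α ∈ Set.Icc 0 1) →
      (∀ α, τ₂ α ∈ Set.Icc 0 (1 - θ)) → ∀ (c : ℕ) (k : ℝ) (σ : SuperIdx p q A₁ A₂),
      ‖shiftedPoly g (blochHamiltonian m τ₁ τ₂ θ d p q k) E σ σ -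
        shiftedPoly g (blochTrunc m τ₁ τ₂ θ d p q c k) E σ σ‖ ≤ F * Real.exp (-γ * c * p) := by
  -- `p` and `q` determine `θ`; when no `θ < 1` belongs to them there is nothing to prove.
  by_cases hex : ∃ θ : ℝ, 0 < q ∧ θ < 1 ∧ (q : ℝ) * (1 - θ) = p
  swap
  · exact ⟨0, le_rfl, fun θ h1 h2 h3 => absurd ⟨θ, h1, h2, h3⟩ hex⟩
  obtain ⟨θ, hq, hθ, hpq⟩ := hex
  have hq' : (0 : ℝ) < q := by exact_mod_cast hq
  have hp : 0 < p := by
    have : (0 : ℝ) < p := by rw [← hpq]; exact mul_pos hq' (by linarith)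
    exact_mod_cast this
  obtain ⟨D, hD, hdiff⟩ := exists_blochTrunc_error m hh₀ hγ hdecay d θ p q hp hθ hpq
  obtain ⟨C, hC, hmat⟩ := exists_hasExpSeriesMatrix m hh₀ hγ hdecay d θ hθ
  obtain ⟨L, hL, hlip⟩ := exists_lipschitz_shiftedPoly (SuperIdx p q A₁ A₂) g E C hC
  refine ⟨L * D, by positivity, ?_⟩
  intro θ' _ _ hpq' τ₁ τ₂ hτ₁ hτ₂ c k σ
  obtain rfl : θ' = θ := by
    have := mul_left_cancel₀ hq'.ne' (hpq'.trans hpq.symm)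
    linarith
  obtain ⟨h1, h2⟩ := hmat θ' p q ⟨le_rfl, le_rfl⟩ hpq τ₁ τ₂ hτ₁ hτ₂
  rw [mul_assoc]
  exact hlip _ _ _ (by positivity)
    (fun α β => (h1.entry α β).norm_le (by positivity) k)
    (fun α β => ((h2 c).entry α β).norm_le (by positivity) k)
    (hdiff τ₁ τ₂ hτ₁ hτ₂ c k) σ σ

/-- Without orbitals in chain 1 there is no interlayer hopping, hence nothing to truncate. -/
theorem blochTrunc_eq_of_isEmpty {A₁ A₂ : Type*} [IsEmpty A₁] (m : Hopping A₁ A₂) (τ₁ : A₁ → ℝ)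
    (τ₂ : A₂ → ℝ) (θ d : ℝ) (p q c : ℕ) (k : ℝ) :
    blochTrunc m τ₁ τ₂ θ d p q c k = blochHamiltonian m τ₁ τ₂ θ d p q k := by
  have hleft : ∀ σ : SuperIdx p q A₁ A₂, σ.isLeft = false := by
    rintro (⟨_, α⟩ | _)
    · exact isEmptyElim α
    · rfl
  have : truncHamiltonian m τ₁ τ₂ θ d p q c = superHamiltonian m τ₁ τ₂ θ d p q := by
    funext x y
    rw [truncHamiltonian, if_neg]
    simp [hleft]
  rw [blochTrunc, blochHamiltonian, this]

/-! ### Orbitals in the home cell -/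

/-- The cell of a home orbital is determined by its type `α`, so there are finitely many. -/
theorem homeOrbitals_finite {A₂ : Type*} [Finite A₂] (τ₂ : A₂ → ℝ) {θ : ℝ} (d : ℝ) (hθ : θ < 1) :
    (homeOrbitals τ₂ θ d).Finite := by
  refine Set.Finite.of_injOn (f := Prod.snd) (t := Set.univ) (fun _ _ => Set.mem_univ _) ?_
    Set.finite_univ
  rintro ⟨n, α⟩ ⟨b, ⟨hb0, hb1⟩, hb⟩ ⟨n', α'⟩ ⟨b', ⟨hb0', hb1'⟩, hb'⟩ h
  dsimp only at h hb hb'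
  subst h
  have hθ' : 0 < 1 - θ := by linarith
  have h1 : b - b' = n - n' := mul_left_cancel₀ hθ'.ne' (by linear_combination hb - hb')
  have h2 : (n : ℝ) - n' < 1 := by rw [← h1]; linarith
  have h3 : (n' : ℝ) - n < 1 := by linarith
  have h4 : n - n' < 1 := by exact_mod_cast h2
  have h5 : n' - n < 1 := by exact_mod_cast h3
  rw [show n = n' by omega]

theorem card_homeIndices_le {A₁ A₂ : Type*} [Fintype A₁] [Fintype A₂] (τ₂ : A₂ → ℝ) {θ : ℝ}
    (d : ℝ) (hθ : θ < 1) (p q : ℕ) :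
    (homeIndices (A₁ := A₁) τ₂ θ d p q).card ≤ (homeOrbitals τ₂ θ d).ncard := by
  classical
  have hmem : ∀ σ ∈ homeIndices (A₁ := A₁) τ₂ θ d p q,
      ∃ n : ℤ, relabel (n, σ) ∈ (Sum.inr '' homeOrbitals τ₂ θ d : Set (Site A₁ A₂)) := by
    intro σ hσ
    obtain ⟨n, x, hx, h⟩ := (Finset.mem_filter.mp hσ).2
    exact ⟨n, x, hx, h.symm⟩
  choose! n hn using hmem
  rw [← Set.ncard_coe_finset,
    ← Set.ncard_image_of_injective (homeOrbitals τ₂ θ d) (Sum.inr_injective (α := ℤ × A₁))]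
  refine Set.ncard_le_ncard_of_injOn (fun σ => relabel (n σ, σ)) hn ?_
    ((homeOrbitals_finite τ₂ d hθ).image _)
  intro σ _ σ' _ h
  exact (Prod.ext_iff.mp (relabel_injective h)).2

/-! ### The error of the local density of states -/

/-- The two sources of error, quadrature and truncation, add up over the home orbitals. -/
theorem norm_ldos_sub_ldosApprox_le {A₁ A₂ : Type*} [Fintype A₁] [Fintype A₂] [DecidableEq A₁]
    [DecidableEq A₂] (m : Hopping A₁ A₂) (g : Polynomial ℝ) (τ₁ : A₁ → ℝ) (τ₂ : A₂ → ℝ) (θ : ℝ)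
    {p q M c : ℕ} (hp : 0 < p) (hM : 0 < M) (d E : ℝ) {w B δ : ℝ} (hw : 0 ≤ w)
    (hB : ∀ σ : SuperIdx p q A₁ A₂, HasExpSeries p w
      (fun k => shiftedPoly g (blochHamiltonian m τ₁ τ₂ θ d p q k) E σ σ) 0 B)
    (hδ : ∀ (k : ℝ) (σ : SuperIdx p q A₁ A₂),
      ‖shiftedPoly g (blochHamiltonian m τ₁ τ₂ θ d p q k) E σ σ -
        shiftedPoly g (blochTrunc m τ₁ τ₂ θ d p q c k) E σ σ‖ ≤ δ) :
    ‖ldos m g τ₁ τ₂ θ p q d E - ldosApprox m g τ₁ τ₂ θ p q M c d E‖ ≤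
      (homeIndices (A₁ := A₁) τ₂ θ d p q).card * (Real.exp (-(w * p * M)) * B + δ) := by
  have hp' : (0 : ℝ) < p := by exact_mod_cast hp
  have hM' : (0 : ℝ) < M := by exact_mod_cast hM
  have hz : 0 < zoneLength p := by unfold zoneLength; positivity
  have hσ : ∀ σ : SuperIdx p q A₁ A₂,
      ‖(∫ k in (0 : ℝ)..(2 * π / p), shiftedPoly g (blochHamiltonian m τ₁ τ₂ θ d p q k) E σ σ) -
        ∑ i ∈ Finset.Icc 1 M,
          shiftedPoly g (blochTrunc m τ₁ τ₂ θ d p q c (2 * π * i / (p * M))) E σ σ *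
            ((2 * π / (p * M) : ℝ) : ℂ)‖ ≤
      zoneLength p * (Real.exp (-(w * p * M)) * B + δ) := by
    intro σ
    have h1 := (hB σ).norm_trapezoid_le hw hp hM
    have h2 : ‖(∑ i ∈ Finset.Icc 1 M,
        shiftedPoly g (blochHamiltonian m τ₁ τ₂ θ d p q (2 * π * i / (p * M))) E σ σ *
          ((2 * π / (p * M) : ℝ) : ℂ)) - ∑ i ∈ Finset.Icc 1 M,
        shiftedPoly g (blochTrunc m τ₁ τ₂ θ d p q c (2 * π * i / (p * M))) E σ σ *
          ((2 * π / (p * M) : ℝ) : ℂ)‖ ≤ zoneLength p * δ := by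
      rw [← Finset.sum_sub_distrib]
      have h3 : ∀ i ∈ Finset.Icc 1 M,
          ‖shiftedPoly g (blochHamiltonian m τ₁ τ₂ θ d p q (2 * π * i / (p * M))) E σ σ *
            ((2 * π / (p * M) : ℝ) : ℂ) -
          shiftedPoly g (blochTrunc m τ₁ τ₂ θ d p q c (2 * π * i / (p * M))) E σ σ *
            ((2 * π / (p * M) : ℝ) : ℂ)‖ ≤ δ * (2 * π / (p * M)) := by
        intro i _
        rw [← sub_mul, norm_mul, Complex.norm_real, Real.norm_of_nonneg (by positivity)]
        exact mul_le_mul_of_nonneg_right (hδ _ σ) (by positivity)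
      refine (norm_sum_le_of_le _ h3).trans (le_of_eq ?_)
      simp only [Finset.sum_const, Nat.card_Icc, add_tsub_cancel_right, nsmul_eq_mul, zoneLength]
      field_simp
    have h4 := norm_sub_le_norm_sub_add_norm_sub
      (∫ k in (0 : ℝ)..(2 * π / p), shiftedPoly g (blochHamiltonian m τ₁ τ₂ θ d p q k) E σ σ)
      (∑ i ∈ Finset.Icc 1 M,
        shiftedPoly g (blochHamiltonian m τ₁ τ₂ θ d p q (2 * π * i / (p * M))) E σ σ *
          ((2 * π / (p * M) : ℝ) : ℂ))
      (∑ i ∈ Finset.Icc 1 M,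
        shiftedPoly g (blochTrunc m τ₁ τ₂ θ d p q c (2 * π * i / (p * M))) E σ σ *
          ((2 * π / (p * M) : ℝ) : ℂ))
    refine (h4.trans (add_le_add h1 h2)).trans (le_of_eq ?_)
    rw [zoneLength]; ring
  rw [ldos, ldosApprox, ← mul_sub, ← Finset.sum_sub_distrib, norm_mul, Complex.norm_real,
    Real.norm_of_nonneg (by positivity)]
  calc _ ≤ 1 / zoneLength p * ((homeIndices (A₁ := A₁) τ₂ θ d p q).card *
        (zoneLength p * (Real.exp (-(w * p * M)) * B + δ))) := by
        gcongr
        refine (norm_sum_le_of_le _ fun σ _ => hσ σ).trans ?_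
        rw [Finset.sum_const, nsmul_eq_mul]
    _ = _ := by field_simp

end CoupledChain

theorem theorem6p1 {A₁ A₂ : Type*} [Fintype A₁] [Fintype A₂] [DecidableEq A₁] [DecidableEq A₂]
    (m : CoupledChain.Hopping A₁ A₂) (h₀ γ : ℝ) (hh₀ : 0 < h₀) (hγ : 0 < γ)
    (hdecay : ∀ x, |m.h x| ≤ h₀ * Real.exp (-γ * |x|))
    (g : Polynomial ℝ) (d E : ℝ) :
    ∃ C₂ : ℕ → ℝ, ∀ θ₀ θ₁ : ℝ, θ₁ < 1 → ∃ C₁ : ℝ,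
      ∀ (θ : ℝ) (p q : ℕ), θ ∈ Set.Icc θ₀ θ₁ → (q : ℝ) * (1 - θ) = p → 0 < q → Nat.Coprime p q →
      ∀ (τ₁ : A₁ → ℝ) (τ₂ : A₂ → ℝ), (∀ α, τ₁ α ∈ Set.Icc 0 1) →
        (∀ α, τ₂ α ∈ Set.Icc 0 (1 - θ)) →
      ∀ M c : ℕ, 1 ≤ M → 3 < c →
        ‖CoupledChain.ldos m g τ₁ τ₂ θ p q d E
            - CoupledChain.ldosApprox m g τ₁ τ₂ θ p q M c d E‖ ≤
          (C₁ / (p * Real.exp (p * γ * M / 2) - p)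
            + C₂ (p * Fintype.card A₁ + q * Fintype.card A₂)
                * Real.exp (-γ * c * p) / (γ * p))
          * ((CoupledChain.homeOrbitals τ₂ θ d).ncard / CoupledChain.zoneLength p) := by
  choose F hF hFerr using
    CoupledChain.exists_shiftedPoly_blochTrunc_error m hh₀ hγ hdecay g d E
  -- If both chains have orbitals then `p, q ≤ N`, so finitely many pairs `(p, q)` belong to `N`.
  set G : ℕ → ℝ := fun N => ∑ x ∈ Finset.range (N + 1) ×ˢ Finset.range (N + 1), F x.1 x.2 with hG
  have hG0 : ∀ N, 0 ≤ G N := fun N => Finset.sum_nonneg fun x _ => hF _ _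
  refine ⟨fun N => 2 * π * γ * G N, fun θ₀ θ₁ hθ₁ => ?_⟩
  obtain ⟨C, hC, hmat⟩ := CoupledChain.exists_hasExpSeriesMatrix m hh₀ hγ hdecay d θ₀ hθ₁
  set B : ℝ := ∑ i ∈ Finset.range (g.natDegree + 1), |g.coeff i| * (C + |E|) ^ i with hB
  have hB0 : 0 ≤ B := Finset.sum_nonneg fun i _ => by positivity
  refine ⟨2 * π * B, ?_⟩
  intro θ p q hθ hpq hq _ τ₁ τ₂ hτ₁ hτ₂ M c hM _
  have hθ1 : θ < 1 := hθ.2.trans_lt hθ₁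
  have hp' : (0 : ℝ) < p := by
    rw [← hpq]; exact mul_pos (by exact_mod_cast hq) (by linarith)
  have hp : 0 < p := by exact_mod_cast hp'
  set N := p * Fintype.card A₁ + q * Fintype.card A₂ with hN
  rcases isEmpty_or_nonempty A₂ with hA₂ | hA₂
  · have h1 : CoupledChain.homeOrbitals τ₂ θ d = ∅ := Set.eq_empty_of_isEmpty _
    have h2 : CoupledChain.homeIndices (A₁ := A₁) τ₂ θ d p q = ∅ := by
      have := CoupledChain.card_homeIndices_le (A₁ := A₁) τ₂ d hθ1 p q
      rw [h1, Set.ncard_empty] at this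
      exact Finset.card_eq_zero.mp (Nat.le_zero.mp this)
    simp [CoupledChain.ldos, CoupledChain.ldosApprox, h1, h2]
  have hδ : ∀ (k : ℝ) (σ : CoupledChain.SuperIdx p q A₁ A₂),
      ‖CoupledChain.shiftedPoly g (CoupledChain.blochHamiltonian m τ₁ τ₂ θ d p q k) E σ σ -
        CoupledChain.shiftedPoly g (CoupledChain.blochTrunc m τ₁ τ₂ θ d p q c k) E σ σ‖ ≤
      G N * Real.exp (-γ * c * p) := by
    intro k σ
    have hG0' := hG0 N
    rcases isEmpty_or_nonempty A₁ with hA₁ | hA₁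
    · rw [CoupledChain.blochTrunc_eq_of_isEmpty, sub_self, norm_zero]
      positivity
    · refine (hFerr p q θ hq hθ1 hpq τ₁ τ₂ hτ₁ hτ₂ c k σ).trans ?_
      gcongr
      have hpN : p ≤ N :=
        (Nat.le_mul_of_pos_right p Fintype.card_pos).trans (Nat.le_add_right _ _)
      have hqN : q ≤ N :=
        (Nat.le_mul_of_pos_right q Fintype.card_pos).trans (Nat.le_add_left _ _)
      exact Finset.single_le_sum (f := fun x : ℕ × ℕ => F x.1 x.2) (fun x _ => hF _ _)
        (a := (p, q)) (by simp only [Finset.mem_product, Finset.mem_range]; omega)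
  have hser : ∀ σ : CoupledChain.SuperIdx p q A₁ A₂, CoupledChain.HasExpSeries p (γ / 2)
      (fun k => CoupledChain.shiftedPoly g (CoupledChain.blochHamiltonian m τ₁ τ₂ θ d p q k) E σ σ)
      0 B := fun σ => by
    simpa using ((hmat θ p q hθ hpq τ₁ τ₂ hτ₁ hτ₂).1.shiftedPoly (by positivity) g E).entry σ σ
  refine (CoupledChain.norm_ldos_sub_ldosApprox_le m g τ₁ τ₂ θ hp hM d E (by positivity)
    hser hδ).trans ?_
  have hcard : ((CoupledChain.homeIndices (A₁ := A₁) τ₂ θ d p q).card : ℝ) ≤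
      (CoupledChain.homeOrbitals τ₂ θ d).ncard := by
    exact_mod_cast CoupledChain.card_homeIndices_le (A₁ := A₁) τ₂ d hθ1 p q
  set X : ℝ := p * γ * M / 2 with hX
  have hX0 : 0 < X := by
    have : (0 : ℝ) < M := by exact_mod_cast hM
    positivity
  have hexp : 0 < Real.exp X - 1 := by linarith [Real.add_one_le_exp X]
  have hquad : Real.exp (-(γ / 2 * p * M)) * B ≤ B / (Real.exp X - 1) := by
    have h1 : -(γ / 2 * p * M) = -X := by rw [hX]; ring
    rw [h1, Real.exp_neg, mul_comm, div_eq_mul_inv]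
    gcongr
    linarith
  have hpe : (p : ℝ) * Real.exp X - p = p * (Real.exp X - 1) := by ring
  have hGN := hG0 N
  calc _ ≤ ((CoupledChain.homeOrbitals τ₂ θ d).ncard : ℝ) *
        (B / (Real.exp X - 1) + G N * Real.exp (-γ * c * p)) := by
        gcongr
    _ = _ := by
      rw [CoupledChain.zoneLength, hpe]
      field_simp
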